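/- **Setting.** Fix $d\ge 2$. Let $N\in\mathbb N$ and $0<\varepsilon<\tfrac12$ satisfy $N\varepsilon^{d-1}=1$. For $k\ge1$ let $$\mathcal D^\varepsilon_k=\{(x_i,v_i)_{1\le i\le k}\in(\mathbb T^d\times\mathbb R^d)^k:\ |x_i-x_j|>\varepsilon\ \text{ for all } i\ne j\},\qquad H_k=\tfrac12\sum_{i=1}^k|v_i|^2,$$ where $\mathbb T^d=(\mathbb R/\mathbb Z)^d$. For $\lambda>0$ let $\mathcal F_{\varepsilon,k,\lambda}$ be the space of measurable functions $f$ defined almost everywhere on $\mathcal D^\varepsilon_k$ such that $$\|f\|_{\varepsilon,k,\lambda}=\operatorname*{ess\,sup}_{\mathcal D^\varepsilon_k}\bigl|f\,e^{\lambda H_k}\bigr|<\infty .$$ Let $\Theta_k(t)$, $t\ge0$, be the transport operator of $k$ hard spheres of diameter $\varepsilon$ with elastic (specular) reflection: $(\Theta_k(t)f)(z)=f(z')$, where $z'$ is the state reached from $z$ by following the dynamics backward in time during $t$. During this motion, each post-collisional contact $x_i-x_j=\varepsilon\omega$, $|\omega|=1$, $\omega\cdot(v_i-v_j)>0$, is replaced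 by the pre-collisional one, with velocities $v_i-((v_i-v_j)\cdot\omega)\omega$ and $v_j+((v_i-v_j)\cdot\omega)\omega$. Set $\Theta_k(t)f(z)=0$ if $z$ has two overlapping particles, or if its backward trajectory is not defined by finitely many non-grazing binary collisions. Let $$\mathcal C_k f(z_1,\dots,z_k)=(N-k)\,\varepsilon^{d-1}\sum_{i=1}^k\int_{\mathbb R^d}\int_{\mathbb S^{d-1}}\omega\cdot(v-v_i)\,f(z_1,\dots,z_k,(x_i+\varepsilon\omega,v))\,d\omega\,dv .$$ The successive-collision operators are $$Q_{n,n+s}(t)=\int_{t\ge t_1\ge\dots\ge t_s\ge0}\Theta_n(t-t_1)\,\mathcal C_n\,\Theta_{n+1}(t_1-t_2)\,\mathcal C_{n+1}\cdots\mathcal C_{n+s-1}\,\Theta_{n+s}(t_s)\,dt_s\cdots dt_1 .$$ **Proposition (continuity of the successive-collision operators).** For every $d\ge2$ there is a constant $C_d>0$, depending only on $d$, such that the following holds for all $N$ and $\varepsilon$ as above, all integers $n,s\ge1$ with $n\le N$, all $t>0$ and $\lambda>0$, and every $f_{n+s}\in\mathcal F_{\varepsilon,n+s,\lambda}$. 1.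 The multiple integral defining $Q_{n,n+s}(t)f_{n+s}$ converges absolutely almost everywhere on $\mathcal D^\varepsilon_n$. Its value depends, up to null sets, only on the almost everywhere class of $f_{n+s}$. 2. For every real $b\ge2$ one has $Q_{n,n+s}(t)f_{n+s}\in\mathcal F_{\varepsilon,n,\lambda(1-1/b)}$, with $$\bigl\|Q_{n,n+s}(t)f_{n+s}\bigr\|_{\varepsilon,n,\lambda(1-\frac1b)}\le e^n\left(\frac{\sqrt b\,C_d\,t}{\lambda^{(d+1)/2}}\right)^{s}\|f_{n+s}\|_{\varepsilon,n+s,\lambda}.$$ -/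

import Mathlib

open MeasureTheory Set
open scoped ENNReal

namespace HardSphere

noncomputable section

/-- The velocity space `ℝ^d`, with its Euclidean structure. -/
abbrev Vel (d : ℕ) : Type := EuclideanSpace ℝ (Fin d)

/-- The unit torus `𝕋^d = (ℝ/ℤ)^d`. -/
abbrev Torus (d : ℕ) : Type := Fin d → UnitAddCircle

/-- Phase space of `n` particles, `(𝕋^d × ℝ^d)^n`, with the product Lebesgue measure. -/
abbrev Config (d n : ℕ) : Type := Fin n → Torus d × Vel d

/-- The projection `ℝ^d → 𝕋^d`. -/
def toTorus {d : ℕ} (u : Vel d) : Torus d := fun k => ((u k : ℝ) : UnitAddCircle)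

/-- The Euclidean (flat) distance on the torus; on each coordinate the norm of `UnitAddCircle` is
the distance to the nearest integer. -/
def torusDist {d : ℕ} (x y : Torus d) : ℝ := Real.sqrt (∑ k, ‖x k - y k‖ ^ 2)

/-- The open domain `𝒟^ε_n`: any two particles are at distance `> ε`. -/
def domain (d n : ℕ) (ε : ℝ) : Set (Config d n) :=
  {z | ∀ i j, i ≠ j → ε < torusDist (z i).1 (z j).1}

/-- The corresponding closed domain, in which contacts are allowed. -/
def closedDomain (d n : ℕ) (ε : ℝ) : Set (Config d n) :=
  {z | ∀ i j, i ≠ j → ε ≤ torusDist (z i).1 (z j).1}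

/-- Free transport backward during a time `τ`: `(x_i, v_i) ↦ (x_i - τ v_i, v_i)`. -/
def freeBack {d n : ℕ} (τ : ℝ) (z : Config d n) : Config d n :=
  fun i => ((z i).1 - toTorus (τ • (z i).2), (z i).2)

/-- Elastic reflection of the velocities of the pair `(i, j)`, where `x_i - x_j = ε ω`:
`v_i' = v_i - ((v_i - v_j)·ω) ω` and `v_j' = v_j + ((v_i - v_j)·ω) ω`. -/
def scatter {d n : ℕ} (i j : Fin n) (ω : Vel d) (z : Config d n) : Config d n :=
  fun k =>
    if k = i then ((z i).1, (z i).2 - (inner ℝ ((z i).2 - (z j).2) ω) • ω)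
    else if k = j then ((z j).1, (z j).2 + (inner ℝ ((z i).2 - (z j).2) ω) • ω)
    else z k

/-- `BackwardTrajectory ε t z z'`: following the hard sphere dynamics of diameter `ε` backward in
time during `t` from `z`, one arrives at `z'` after finitely many collisions, all of them binary
and non-grazing. When the backward motion reaches a contact, the state there is post-collisional,
and it is replaced by the pre-collisional one. The case `τ = 0` of `collide` treats an initial
state which is itself a post-collisional contact. -/
inductive BackwardTrajectory {d n : ℕ} (ε : ℝ) : ℝ → Config d n → Config d n → Prop
  | free (t : ℝ) (z : Config d n) (ht : 0 ≤ t) (hz : z ∈ closedDomain d n ε)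
      (hfree : ∀ τ, 0 < τ → τ < t → freeBack τ z ∈ domain d n ε) :
      BackwardTrajectory ε t z (freeBack t z)
  | collide (τ r : ℝ) (z z' : Config d n) (i j : Fin n) (ω : Vel d)
      (hτ : 0 ≤ τ) (hr : 0 < r) (hij : i ≠ j) (hω : ‖ω‖ = 1)
      (hfree : ∀ σ, 0 < σ → σ < τ → freeBack σ z ∈ domain d n ε)
      (hcontact : (freeBack τ z i).1 = (freeBack τ z j).1 + toTorus (ε • ω))
      (hothers : ∀ k l, k ≠ l → s(k, l) ≠ s(i, j) →
        ε < torusDist (freeBack τ z k).1 (freeBack τ z l).1)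
      (hpost : 0 < inner ℝ ω ((z i).2 - (z j).2))
      (hrest : BackwardTrajectory ε r (scatter i j ω (freeBack τ z)) z') :
      BackwardTrajectory ε (τ + r) z z'

open Classical in
/-- The transport operator `Θ_n(t)`, `t ≥ 0`, of hard spheres with specular reflection:
`(Θ_n(t) f)(z) = f(z')`, where `z'` is the endpoint of the backward trajectory of duration `t`
from `z`. It is `0` at the states (overlapping ones and exceptional ones) from which there is no
such trajectory. -/
def transport {d n : ℕ} {M : Type} [Zero M] (ε t : ℝ) (f : Config d n → M) : Config d n → M :=
  fun z => if h : ∃ z', BackwardTrajectory ε t z z' then f h.choose else 0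

/-- The state `(z_n, x_i + ε ω, v)` of `n + 1` particles. -/
def adjoin {d n : ℕ} (ε : ℝ) (z : Config d n) (i : Fin n) (ω v : Vel d) : Config d (n + 1) :=
  Fin.snoc (α := fun _ => Torus d × Vel d) z ((z i).1 + toTorus (ε • ω), v)

/-- The measure `dω dv` on `𝕊^{d-1} × ℝ^d`. -/
def collisionMeasure (d : ℕ) : Measure (Metric.sphere (0 : Vel d) 1 × Vel d) :=
  (volume : Measure (Vel d)).toSphere.prod volume

/-- The collision operator
`C_n f (z_n) = (N - n) ε^{d-1} ∑_i ∫∫ ω·(v - v_i) f(z_n, x_i + ε ω, v) dω dv`. -/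
def collision (d N : ℕ) (ε : ℝ) (n : ℕ) (f : Config d (n + 1) → ℝ) : Config d n → ℝ :=
  fun z => ((N : ℝ) - n) * ε ^ (d - 1) *
    ∑ i, ∫ p, inner ℝ (p.1 : Vel d) (p.2 - (z i).2) * f (adjoin ε z i p.1 p.2)
      ∂(collisionMeasure d)

/-- `C_n` with every term replaced by its absolute value, acting on `[0, ∞]`-valued functions. -/
def absCollision (d N : ℕ) (ε : ℝ) (n : ℕ) (g : Config d (n + 1) → ℝ≥0∞) : Config d n → ℝ≥0∞ :=
  fun z => ‖((N : ℝ) - n) * ε ^ (d - 1)‖ₑ *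
    ∑ i, ∫⁻ p, ‖(inner ℝ (p.1 : Vel d) (p.2 - (z i).2) : ℝ)‖ₑ * g (adjoin ε z i p.1 p.2)
      ∂(collisionMeasure d)

/-- For times `θ = (t_0, …, t_s)` and collision operators `K_m`, the composition
`Θ_n(t_0 - t_1) K_n Θ_{n+1}(t_1 - t_2) K_{n+1} ⋯ Θ_{n+s-1}(t_{s-1} - t_s) K_{n+s-1}`. -/
def chain {d : ℕ} {M : Type} [Zero M] (ε : ℝ)
    (K : (m : ℕ) → (Config d (m + 1) → M) → Config d m → M) (n : ℕ) :
    (s : ℕ) → (Fin (s + 1) → ℝ) → (Config d (n + s) → M) → Config d n → M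
  | 0, _, f => f
  | s + 1, θ, f =>
      chain ε K n s (Fin.init θ)
        (transport ε (θ (Fin.last s).castSucc - θ (Fin.last (s + 1))) (K (n + s) f))

/-- The simplex of ordered times `t ≥ t_1 ≥ ⋯ ≥ t_s ≥ 0`; the entry of index `k : Fin s` is
`t_{k+1}`. -/
def timeSimplex (s : ℕ) (t : ℝ) : Set (Fin s → ℝ) :=
  {τ | Antitone τ ∧ ∀ k, 0 ≤ τ k ∧ τ k ≤ t}

/-- The successive-collision operator `Q_{n,n+s}(t)`: the integral over `t ≥ t_1 ≥ ⋯ ≥ t_s ≥ 0` of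
`Θ_n(t - t_1) C_n Θ_{n+1}(t_1 - t_2) C_{n+1} ⋯ C_{n+s-1} Θ_{n+s}(t_s) f`. -/
def Q (d N : ℕ) (ε : ℝ) (n s : ℕ) (t : ℝ) (f : Config d (n + s) → ℝ) : Config d n → ℝ :=
  fun z => ∫ τ in timeSimplex s t,
    chain ε (collision d N ε) n s (Fin.cons t τ)
      (transport ε ((Fin.cons t τ : Fin (s + 1) → ℝ) (Fin.last s)) f) z

/-- The multiple integral that defines `Q_{n,n+s}(t) f`, with the integrand replaced by its absolute
value: it is finite exactly where the multiple integral converges absolutely. -/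
def absQ (d N : ℕ) (ε : ℝ) (n s : ℕ) (t : ℝ) (f : Config d (n + s) → ℝ) : Config d n → ℝ≥0∞ :=
  fun z => ∫⁻ τ in timeSimplex s t,
    chain ε (absCollision d N ε) n s (Fin.cons t τ)
      (transport ε ((Fin.cons t τ : Fin (s + 1) → ℝ) (Fin.last s)) (fun w => ‖f w‖ₑ)) z

/-- The total kinetic energy `H_k = ½ ∑ |v_i|²`. -/
def kineticEnergy {d k : ℕ} (z : Config d k) : ℝ := 1 / 2 * ∑ i, ‖(z i).2‖ ^ 2

/-- Lebesgue measure on the restricted domain `𝒟^ε_k`. -/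
def domainMeasure (d k : ℕ) (ε : ℝ) : Measure (Config d k) := volume.restrict (domain d k ε)

/-- The weighted norm `‖f‖_{ε,k,λ} = supess_{𝒟^ε_k} |f exp(λ H_k)|`, with values in `[0, ∞]`. -/
def weightedNorm {d k : ℕ} (ε lam : ℝ) (f : Config d k → ℝ) : ℝ≥0∞ :=
  eLpNorm (fun z => f z * Real.exp (lam * kineticEnergy z)) ∞ (domainMeasure d k ε)

/-- Membership in the space `ℱ_{ε,k,λ}`. Functions are given by representatives, whose values off
`𝒟^ε_k` or on a null set are irrelevant. -/
def MemWeighted {d k : ℕ} (ε lam : ℝ) (f : Config d k → ℝ) : Prop :=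
  AEStronglyMeasurable f (domainMeasure d k ε) ∧ weightedNorm ε lam f < ∞

end

end HardSphere

namespace HardSphere

noncomputable section

open scoped Pointwise

set_option synthInstance.maxSize 2000

/-! ### Geometry of the torus -/

section Geometry

variable {d n : ℕ}

/-! The estimate is of Lanford type. Transport conserves kinetic energy, so it keeps every bound `c
* gauss μ` (`transport_le_gauss`). A collision operator `C_m` integrates one velocity out against
its Gaussian, and the factor `∑ |v_i|` that remains is absorbed by giving up a part `δ` of the
weight, because `(∑ |v_i|) exp(-δH) ≤ √(m/δ)` (`absCollision_le_gauss`). When the total loss `λ/b`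
is shared equally among the `s` collisions, each of them costs at most a constant times `(n+s) √b /
λ^((d+1)/2)` (`collisionBound_le`). The time simplex has volume at most `t^s/s!`, and `(n+s)^s/s! ≤
e^(n+s)` produces `e^n` times an `s`-th power.

The delicate point is that `f` is known only almost everywhere, whereas `C_m` evaluates its argument
at contacts, a set of codimension one. The time integral restores the missing dimension: the
parameters `(t, z, ω, v)` number `1 + 2dm + (d-1) + d = 2d(m+1)`, the dimension of the phase space
of `m+1` particles. It has to be shown that the parameters whose backward trajectory ends in a null
set form a null set (`collisionReach_null`; `volume_reach_eq_zero` is the analogue at a fixed time).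

No Jacobian is computed. A trajectory leaving a pre-collisional contact backward is stopped at a
rational remaining time, before its next collision. From the state reached there, forward free
flight recovers the contact, its direction and the elapsed time as differentiable functions of that
state. By induction on the number of collisions that state lies in a null set, and differentiable
maps between spaces of equal dimension send null sets to null sets. The numbers of collisions,
rational times, pairs and lattice vectors give a countable union. Almost everywhere existence of the
dynamics is not needed, since transport vanishes where no trajectory exists.

`chain_congr_ae` iterates this along the collisions. Then `f` may be replaced by a Borel function
that satisfies its Gaussian bound everywhere, and all estimates become pointwise. -/

lemma toTorus_add (u v : Vel d) : toTorus (u + v) = toTorus u + toTorus v := by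
  funext k; simp [toTorus]

lemma toTorus_sub (u v : Vel d) : toTorus (u - v) = toTorus u - toTorus v := by
  funext k; simp [toTorus]

lemma toTorus_zero : toTorus (0 : Vel d) = 0 := by
  funext k; simp [toTorus]

lemma continuous_toTorus : Continuous (toTorus : Vel d → Torus d) := by
  unfold toTorus
  refine continuous_pi fun k => ?_
  exact (AddCircle.continuous_mk' (1 : ℝ)).comp (by fun_prop)

lemma torusDist_toTorus_zero_le (u : Vel d) (x : Torus d) : torusDist (x + toTorus u) x ≤ ‖u‖ := by
  rw [EuclideanSpace.norm_eq]
  unfold torusDist toTorus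
  refine Real.sqrt_le_sqrt (Finset.sum_le_sum fun k _ => ?_)
  simp only [Pi.add_apply, add_sub_cancel_left]
  gcongr
  rw [UnitAddCircle.norm_eq]
  simpa using round_le (u k) 0

lemma abs_apply_le_norm (u : Vel d) (k : Fin d) : |u k| ≤ ‖u‖ := by
  simpa using PiLp.norm_apply_le u k

/-- As `ε < 1/2`, every coordinate of `εω` is its own representative nearest to zero, so the flat
distance is the Euclidean norm. -/
lemma torusDist_contact {ε : ℝ} (h0 : 0 < ε) (h1 : ε < 1 / 2) {ω : Vel d} (hω : ‖ω‖ = 1)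
    (x : Torus d) : torusDist (x + toTorus (ε • ω)) x = ε := by
  have hn : ‖ε • ω‖ = ε := by rw [norm_smul, hω, Real.norm_of_nonneg h0.le, mul_one]
  conv_rhs => rw [← hn, EuclideanSpace.norm_eq]
  unfold torusDist toTorus
  congr 1
  refine Finset.sum_congr rfl fun k _ => ?_
  simp only [Pi.add_apply, add_sub_cancel_left]
  congr 1
  rw [(AddCircle.norm_coe_eq_abs_iff (1 : ℝ) one_ne_zero).2, Real.norm_eq_abs]
  have := abs_apply_le_norm (ε • ω) k
  rw [abs_one]
  linarith

/-- The lattice vector with integer coordinates `l`. -/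
def lattice (l : Fin d → ℤ) : Vel d := WithLp.toLp 2 fun k => (l k : ℝ)

lemma lattice_apply (l : Fin d → ℤ) (k : Fin d) : lattice l k = l k := rfl

lemma toTorus_eq_iff {u v : Vel d} : toTorus u = toTorus v ↔ ∃ l : Fin d → ℤ, u = v + lattice l := by
  constructor
  · intro h
    have : ∀ k, ∃ m : ℤ, u k = v k + m := fun k => by
      have hk := congrFun h k
      simp only [toTorus] at hk
      rw [← sub_eq_zero, ← AddCircle.coe_sub, AddCircle.coe_eq_zero_iff] at hk
      obtain ⟨m, hm⟩ := hk
      exact ⟨m, by simp at hm; linarith⟩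
    choose l hl using this
    refine ⟨l, ?_⟩
    ext k
    simpa [lattice_apply] using hl k
  · rintro ⟨l, rfl⟩
    funext k
    simp [toTorus, lattice_apply]

/-- The two vectors differ by a lattice vector with all coordinates of modulus below `2ε < 1`, hence
by zero. A contact therefore determines its direction. -/
lemma toTorus_smul_injective {ε : ℝ} (h0 : 0 < ε) (h1 : ε < 1 / 2) {ω ω' : Vel d} (hω : ‖ω‖ = 1)
    (hω' : ‖ω'‖ = 1) (h : toTorus (ε • ω) = toTorus (ε • ω')) : ω = ω' := by
  obtain ⟨l, hl⟩ := toTorus_eq_iff.1 h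
  have hl0 : lattice l = 0 := by
    ext k
    have hk : (ε • ω) k = (ε • ω') k + l k := by rw [hl]; rfl
    have a1 := abs_apply_le_norm (ε • ω) k
    have a2 := abs_apply_le_norm (ε • ω') k
    rw [norm_smul, Real.norm_of_nonneg h0.le, hω, mul_one, abs_le] at a1
    rw [norm_smul, Real.norm_of_nonneg h0.le, hω', mul_one, abs_le] at a2
    have : |(l k : ℝ)| < 1 := by rw [abs_lt]; constructor <;> linarith
    have h3 : l k = 0 := by
      rw [← Int.cast_abs] at this
      exact Int.abs_lt_one_iff.1 (by exact_mod_cast this)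
    simp [lattice_apply, h3]
  rw [hl0, add_zero] at hl
  exact smul_right_injective _ h0.ne' hl

end Geometry

/-! ### Free flights, contacts and scattering -/

section Dynamics

variable {d n : ℕ} {ε : ℝ}

@[simp] lemma freeBack_snd (τ : ℝ) (z : Config d n) (i : Fin n) :
    (freeBack τ z i).2 = (z i).2 := rfl

lemma freeBack_fst (τ : ℝ) (z : Config d n) (i : Fin n) :
    (freeBack τ z i).1 = (z i).1 - toTorus (τ • (z i).2) := rfl

@[simp] lemma freeBack_zero (z : Config d n) : freeBack 0 z = z := by
  funext i; simp [freeBack, toTorus_zero]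

lemma freeBack_freeBack (a b : ℝ) (z : Config d n) :
    freeBack a (freeBack b z) = freeBack (a + b) z := by
  funext i
  simp only [freeBack, Prod.mk.injEq, and_true, add_smul, toTorus_add]
  abel

lemma continuous_freeBack_uncurry :
    Continuous fun p : ℝ × Config d n => freeBack p.1 p.2 := by
  unfold freeBack
  have := continuous_toTorus (d := d)
  fun_prop

lemma continuous_torusDist_apply (i j : Fin n) :
    Continuous fun z : Config d n => torusDist (z i).1 (z j).1 := by
  unfold torusDist
  fun_prop

lemma isClosed_closedDomain : IsClosed (closedDomain d n ε) := by
  have : closedDomain d n ε =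
      ⋂ (i) (j) (_ : i ≠ j), {z | ε ≤ torusDist (z i).1 (z j).1} := by
    ext z; simp [closedDomain]
  rw [this]
  exact isClosed_iInter fun i => isClosed_iInter fun j => isClosed_iInter fun _ =>
    isClosed_le continuous_const (continuous_torusDist_apply i j)

lemma isOpen_domain : IsOpen (domain d n ε) := by
  have : domain d n ε = ⋂ (i) (j) (_ : i ≠ j), {z | ε < torusDist (z i).1 (z j).1} := by
    ext z; simp [domain]
  rw [this]
  exact isOpen_iInter_of_finite fun i => isOpen_iInter_of_finite fun j =>
    isOpen_iInter_of_finite fun _ => isOpen_lt continuous_const (continuous_torusDist_apply i j)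

lemma domain_subset_closedDomain : domain d n ε ⊆ closedDomain d n ε :=
  fun _ hz i j hij => (hz i j hij).le

/-- A binary contact of the pair `(i, j)`, in post-collisional configuration, with all other pairs
separated. -/
structure PostContact (ε : ℝ) (y : Config d n) (i j : Fin n) (ω : Vel d) : Prop where
  ne : i ≠ j
  norm_eq : ‖ω‖ = 1
  contact : (y i).1 = (y j).1 + toTorus (ε • ω)
  others : ∀ k l, k ≠ l → s(k, l) ≠ s(i, j) → ε < torusDist (y k).1 (y l).1
  post : 0 < inner ℝ ω ((y i).2 - (y j).2)

lemma contact_unique (h0 : 0 < ε) (h1 : ε < 1 / 2) {y : Config d n} {i j k l : Fin n}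
    {ω ω' : Vel d} (hij : i ≠ j) (hω : ‖ω‖ = 1) (hω' : ‖ω'‖ = 1)
    (hc : (y i).1 = (y j).1 + toTorus (ε • ω)) (hc' : (y k).1 = (y l).1 + toTorus (ε • ω'))
    (hs : s(k, l) = s(i, j)) : (k = i ∧ l = j ∧ ω' = ω) ∨ (k = j ∧ l = i ∧ ω' = -ω) := by
  rcases Sym2.eq_iff.1 hs with ⟨rfl, rfl⟩ | ⟨rfl, rfl⟩
  · refine Or.inl ⟨rfl, rfl, toTorus_smul_injective h0 h1 hω' hω ?_⟩
    exact add_left_cancel (hc'.symm.trans hc)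
  · refine Or.inr ⟨rfl, rfl, toTorus_smul_injective h0 h1 hω' (by simpa using hω) ?_⟩
    have : toTorus (ε • -ω) = - toTorus (ε • ω) := by
      rw [smul_neg, ← zero_sub, toTorus_sub, toTorus_zero, zero_sub]
    rw [this, eq_neg_iff_add_eq_zero]
    rw [hc] at hc'
    have := hc'.symm
    rw [add_assoc, add_eq_left, add_comm] at this
    exact this

lemma scatter_fst (i j : Fin n) (ω : Vel d) (z : Config d n) (k : Fin n) :
    (scatter i j ω z k).1 = (z k).1 := by
  unfold scatter; split_ifs with h1 h2 <;> simp_all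

lemma scatter_snd_left (i j : Fin n) (ω : Vel d) (z : Config d n) :
    (scatter i j ω z i).2 = (z i).2 - (inner ℝ ((z i).2 - (z j).2) ω) • ω := by
  simp [scatter]

lemma scatter_snd_right {i j : Fin n} (hij : i ≠ j) (ω : Vel d) (z : Config d n) :
    (scatter i j ω z j).2 = (z j).2 + (inner ℝ ((z i).2 - (z j).2) ω) • ω := by
  simp [scatter, hij.symm]

lemma scatter_snd_of_ne {i j k : Fin n} (hi : k ≠ i) (hj : k ≠ j) (ω : Vel d) (z : Config d n) :
    (scatter i j ω z k).2 = (z k).2 := by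
  simp [scatter, hi, hj]

/-- A contact has two labellings, `(i, j, ω)` and `(j, i, -ω)`. The reflected state must not depend
on the choice for the dynamics to be deterministic. -/
lemma scatter_symm {i j : Fin n} (hij : i ≠ j) (ω : Vel d) (z : Config d n) :
    scatter j i (-ω) z = scatter i j ω z := by
  funext k
  unfold scatter
  have : (inner ℝ ((z j).2 - (z i).2) (-ω) : ℝ) = inner ℝ ((z i).2 - (z j).2) ω := by
    rw [inner_neg_right, ← neg_sub (z i).2, inner_neg_left, neg_neg]
  split_ifs with h1 h2 h3
  · exact absurd (h2.symm.trans h1) hij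
  · rw [this]; simp
  · rw [this]; simp [sub_eq_add_neg]
  · rfl

lemma inner_scatter {i j : Fin n} (hij : i ≠ j) {ω : Vel d} (hω : ‖ω‖ = 1) (z : Config d n) :
    (inner ℝ ((scatter i j ω z i).2 - (scatter i j ω z j).2) ω : ℝ)
      = - inner ℝ ((z i).2 - (z j).2) ω := by
  rw [scatter_snd_left, scatter_snd_right hij]
  simp only [inner_sub_left, inner_add_left, inner_smul_left, real_inner_self_eq_norm_sq, hω]
  simp

/-- Going backward from a post-collisional contact, the lifted squared distance is `ε² - 2σε(ω·w) +
σ²|w|²`, which is below `ε²` for small `σ > 0`: free flight would make the spheres overlap, so the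
reflection is forced. -/
lemma exists_not_mem_domain_of_contact (h0 : 0 < ε) {y : Config d n} {i j : Fin n} {ω : Vel d}
    (hij : i ≠ j) (hω : ‖ω‖ = 1) (hc : (y i).1 = (y j).1 + toTorus (ε • ω))
    (hp : 0 < inner ℝ ω ((y i).2 - (y j).2)) :
    ∃ δ, 0 < δ ∧ ∀ σ, 0 < σ → σ < δ → freeBack σ y ∉ domain d n ε := by
  set w := (y i).2 - (y j).2 with hw
  refine ⟨2 * ε * inner ℝ ω w / (‖w‖ ^ 2 + 1), by positivity, fun σ hσ hσ' hd => ?_⟩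
  have h2 := hd i j hij
  have e : (freeBack σ y i).1 = (freeBack σ y j).1 + toTorus (ε • ω - σ • w) := by
    rw [freeBack_fst, freeBack_fst, hc, hw, smul_sub, toTorus_sub, toTorus_sub]
    abel
  rw [e] at h2
  have h3 := h2.trans_le (torusDist_toTorus_zero_le _ _)
  have h4 : ‖ε • ω - σ • w‖ ^ 2 = ε ^ 2 - 2 * (σ * ε * inner ℝ ω w) + σ ^ 2 * ‖w‖ ^ 2 := by
    rw [norm_sub_sq_real, norm_smul, norm_smul, hω, Real.norm_of_nonneg h0.le,
      Real.norm_of_nonneg hσ.le, inner_smul_left, inner_smul_right]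
    simp
    ring
  have h5 : ε ^ 2 < ‖ε • ω - σ • w‖ ^ 2 := by gcongr
  rw [lt_div_iff₀ (by positivity)] at hσ'
  have h6 : σ * (σ * (‖w‖ ^ 2 + 1)) < σ * (2 * ε * inner ℝ ω w) := by gcongr
  nlinarith

lemma not_postContact_of_inner_neg (h0 : 0 < ε) (h1 : ε < 1 / 2) {y : Config d n} {i j k l : Fin n}
    {ω ω' : Vel d} (hij : i ≠ j) (hω : ‖ω‖ = 1) (hc : (y i).1 = (y j).1 + toTorus (ε • ω))
    (hneg : (inner ℝ ω ((y i).2 - (y j).2) : ℝ) < 0) : ¬ PostContact ε y k l ω' := by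
  intro h
  have hs : s(k, l) = s(i, j) := by
    by_contra hs
    have := h.others i j hij (Ne.symm hs)
    rw [hc, torusDist_contact h0 h1 hω] at this
    exact lt_irrefl _ this
  have hp := h.post
  rcases contact_unique h0 h1 hij hω h.norm_eq hc h.contact hs with ⟨rfl, rfl, rfl⟩ | ⟨rfl, rfl, rfl⟩
  · linarith
  · rw [inner_neg_left, ← inner_neg_right, neg_sub] at hp
    linarith

lemma PostContact.scatter_inner_neg {y : Config d n} {i j : Fin n} {ω : Vel d}
    (h : PostContact ε y i j ω) :
    (inner ℝ ω ((scatter i j ω y i).2 - (scatter i j ω y j).2) : ℝ) < 0 := by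
  rw [real_inner_comm, inner_scatter h.ne h.norm_eq, real_inner_comm]
  linarith [h.post]

lemma kineticEnergy_freeBack (τ : ℝ) (z : Config d n) :
    kineticEnergy (freeBack τ z) = kineticEnergy z := rfl

lemma kineticEnergy_scatter {i j : Fin n} (hij : i ≠ j) {ω : Vel d} (hω : ‖ω‖ = 1)
    (z : Config d n) : kineticEnergy (scatter i j ω z) = kineticEnergy z := by
  unfold kineticEnergy
  congr 1
  rw [← Finset.add_sum_erase _ _ (Finset.mem_univ i),
    ← Finset.add_sum_erase _ _ (Finset.mem_univ i),
    ← Finset.add_sum_erase _ _ (Finset.mem_erase.2 ⟨hij.symm, Finset.mem_univ j⟩),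
    ← Finset.add_sum_erase (Finset.univ.erase i) (fun x => ‖(z x).2‖ ^ 2)
      (Finset.mem_erase.2 ⟨hij.symm, Finset.mem_univ j⟩)]
  rw [← add_assoc, ← add_assoc]
  congr 1
  · rw [scatter_snd_left, scatter_snd_right hij, norm_sub_sq_real, norm_add_sq_real, norm_smul, hω,
      inner_smul_right, inner_smul_right, inner_sub_left, mul_one, Real.norm_eq_abs, sq_abs]
    ring
  · refine Finset.sum_congr rfl fun k hk => ?_
    rw [Finset.mem_erase, Finset.mem_erase] at hk
    rw [scatter_snd_of_ne hk.2.1 hk.1]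

lemma BackwardTrajectory.kineticEnergy_eq {t : ℝ} {z z' : Config d n}
    (h : BackwardTrajectory ε t z z') : kineticEnergy z' = kineticEnergy z := by
  induction h with
  | free => rfl
  | collide τ r z z' i j ω hτ hr hij hω _ _ _ _ _ ih =>
    rw [ih, kineticEnergy_scatter hij hω, kineticEnergy_freeBack]

lemma BackwardTrajectory.nonneg {t : ℝ} {z z' : Config d n}
    (h : BackwardTrajectory ε t z z') : 0 ≤ t := by
  cases h <;> linarith

/-- The endpoint may be a contact, so only the closed domain can be reached. This suffices because
the two domains differ by a null set (`volume_closedDomain_diff_domain`). -/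
lemma BackwardTrajectory.mem_closedDomain {t : ℝ} {z z' : Config d n}
    (h : BackwardTrajectory ε t z z') : z' ∈ closedDomain d n ε := by
  induction h with
  | free t z ht hz hfree =>
    rcases ht.eq_or_lt with rfl | ht
    · simpa using hz
    · have hcont : Continuous fun σ : ℝ => freeBack σ z :=
        continuous_freeBack_uncurry.comp (by fun_prop : Continuous fun σ : ℝ => (σ, z))
      have hcl : IsClosed ((fun σ : ℝ => freeBack σ z) ⁻¹' closedDomain d n ε) :=
        isClosed_closedDomain.preimage hcont
      have : closure (Ioo 0 t) ⊆ (fun σ : ℝ => freeBack σ z) ⁻¹' closedDomain d n ε :=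
        closure_minimal (fun σ hσ => domain_subset_closedDomain (hfree σ hσ.1 hσ.2)) hcl
      rw [closure_Ioo ht.ne] at this
      exact this ⟨ht.le, le_rfl⟩
  | collide => assumption

end Dynamics

/-! ### Trajectories with a prescribed number of collisions -/

section Reach

variable {d n : ℕ}

/-- The pairs `(t, z)` for which the backward trajectory of duration `t` from `z` has exactly `k`
collisions and ends in `A`. -/
def reach (ε : ℝ) : ℕ → Set (Config d n) → Set (ℝ × Config d n)
  | 0, A => {q | 0 ≤ q.1 ∧ q.2 ∈ closedDomain d n ε ∧
      (∀ σ, 0 < σ → σ < q.1 → freeBack σ q.2 ∈ domain d n ε) ∧ freeBack q.1 q.2 ∈ A}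
  | k + 1, A => {q | ∃ i j ω τ, 0 ≤ τ ∧ τ < q.1 ∧
      (∀ σ, 0 < σ → σ < τ → freeBack σ q.2 ∈ domain d n ε) ∧
      PostContact ε (freeBack τ q.2) i j ω ∧
      (q.1 - τ, scatter i j ω (freeBack τ q.2)) ∈ reach ε k A}

variable {ε : ℝ}

lemma exists_backwardTrajectory_iff {A : Set (Config d n)} {t : ℝ} {z : Config d n} :
    (∃ z' ∈ A, BackwardTrajectory ε t z z') ↔ (t, z) ∈ ⋃ k, reach ε k A := by
  rw [mem_iUnion]
  constructor
  · rintro ⟨z', hz', h⟩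
    induction h with
    | free t z ht hz hfree => exact ⟨0, ht, hz, hfree, hz'⟩
    | collide τ r z z' i j ω hτ hr hij hω hfree hc ho hp _ ih =>
      obtain ⟨k, hk⟩ := ih hz'
      exact ⟨k + 1, i, j, ω, τ, hτ, by simpa using hr, hfree, ⟨hij, hω, hc, ho, hp⟩,
        by simpa using hk⟩
  · rintro ⟨k, hk⟩
    induction k generalizing t z with
    | zero => exact ⟨_, hk.2.2.2, .free t z hk.1 hk.2.1 hk.2.2.1⟩
    | succ k ih =>
      obtain ⟨i, j, ω, τ, hτ, hr, hfree, hp, h⟩ := hk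
      obtain ⟨z', hz', h'⟩ := ih h
      refine ⟨z', hz', ?_⟩
      have := BackwardTrajectory.collide τ (t - τ) z z' i j ω hτ (sub_pos.2 hr) hp.ne hp.norm_eq
        hfree hp.contact hp.others hp.post h'
      rwa [add_sub_cancel] at this

/-- Either a reflection is due at time zero, or there is a short free flight along which the
trajectory can be restarted with the same number of collisions. The second case supplies the
rational remaining times used below. -/
lemma reach_advance {A : Set (Config d n)} {k : ℕ} {t : ℝ} {z : Config d n} (ht : 0 < t)
    (h : (t, z) ∈ reach ε k A) :
    (∃ m i j ω, PostContact ε z i j ω ∧ (t, scatter i j ω z) ∈ reach ε m A) ∨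
      ∃ δ, 0 < δ ∧ δ ≤ t ∧ ∀ s, 0 < s → s < δ →
        freeBack s z ∈ domain d n ε ∧ (t - s, freeBack s z) ∈ reach ε k A := by
  cases k with
  | zero =>
    obtain ⟨h1, h2, h3, h4⟩ := h
    refine Or.inr ⟨t, ht, le_rfl, fun s hs hst => ⟨h3 s hs hst, by simp; linarith, ?_, ?_, ?_⟩⟩
    · exact domain_subset_closedDomain (h3 s hs hst)
    · intro σ h5 h6
      rw [freeBack_freeBack]
      exact h3 _ (by linarith) (by simp at h6 ⊢; linarith)
    · simpa [freeBack_freeBack] using h4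
  | succ k =>
    obtain ⟨i, j, ω, τ, hτ, hr, hfree, hp, h⟩ := h
    rcases hτ.eq_or_lt with rfl | hτ
    · simp only [freeBack_zero, sub_zero] at hp h
      exact Or.inl ⟨k, i, j, ω, hp, h⟩
    · refine Or.inr ⟨τ, hτ, hr.le, fun s hs hst => ⟨hfree s hs hst, i, j, ω, τ - s, by linarith,
        by simpa using hr,
        ?_, ?_, ?_⟩⟩
      · intro σ h5 h6
        rw [freeBack_freeBack]
        exact hfree _ (by linarith) (by linarith)
      · simpa [freeBack_freeBack] using hp
      · simpa [freeBack_freeBack] using h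

/-- Free flight cannot continue past a post-collisional contact (`key`), so both trajectories have
the same first collision time. The contact there is unique up to relabelling, which `scatter_symm`
makes harmless. -/
lemma BackwardTrajectory.unique (h0 : 0 < ε) (h1 : ε < 1 / 2) {t : ℝ} {z z' z'' : Config d n}
    (h : BackwardTrajectory ε t z z') (h' : BackwardTrajectory ε t z z'') : z' = z'' := by
  have key : ∀ (z : Config d n) (a b : ℝ) (i j : Fin n) (ω : Vel d), 0 ≤ a → a < b →
      PostContact ε (freeBack a z) i j ω →
      ¬ ∀ σ, 0 < σ → σ < b → freeBack σ z ∈ domain d n ε := by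
    intro z a b i j ω ha hab hp hf
    obtain ⟨δ, hδ, hn⟩ := exists_not_mem_domain_of_contact h0 hp.ne hp.norm_eq hp.contact hp.post
    obtain ⟨σ, hσ, hσ'⟩ := exists_between (lt_min hδ (sub_pos.2 hab))
    rw [lt_min_iff] at hσ'
    refine hn σ hσ hσ'.1 ?_
    rw [freeBack_freeBack]
    exact hf _ (by linarith) (by linarith [hσ'.2])
  induction h generalizing z'' with
  | free t z ht hz hfree =>
    cases h' with
    | free => rfl
    | collide τ r _ _ i j ω hτ hr hij hω hfree' hc ho hp hrest =>
      exact absurd hfree (key z τ _ i j ω hτ (by linarith) ⟨hij, hω, hc, ho, hp⟩)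
  | collide τ r z z' i j ω hτ hr hij hω hfree hc ho hp hrest ih =>
    generalize hT : τ + r = T at h'
    cases h' with
    | free _ _ _ _ hfree' =>
      exact absurd hfree' (key z τ _ i j ω hτ (by linarith) ⟨hij, hω, hc, ho, hp⟩)
    | collide τ' r' _ _ i' j' ω' hτ' hr' hij' hω' hfree' hc' ho' hp' hrest' =>
      have hττ : τ = τ' := by
        rcases lt_trichotomy τ τ' with hlt | heq | hlt
        · exact absurd hfree' (key z τ _ i j ω hτ hlt ⟨hij, hω, hc, ho, hp⟩)
        · exact heq
        · exact absurd hfree (key z τ' _ i' j' ω' hτ' hlt ⟨hij', hω', hc', ho', hp'⟩)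
      subst hττ
      have hrr : r = r' := by linarith
      subst hrr
      have hs : s(i', j') = s(i, j) := by
        by_contra hs
        have := ho i' j' hij' hs
        rw [hc', torusDist_contact h0 h1 hω'] at this
        exact lt_irrefl _ this
      rcases contact_unique h0 h1 hij hω hω' hc hc' hs with ⟨rfl, rfl, rfl⟩ | ⟨rfl, rfl, rfl⟩
      · exact ih hrest'
      · rw [scatter_symm hij] at hrest'
        exact ih hrest'

lemma transport_eq (h0 : 0 < ε) (h1 : ε < 1 / 2) {M : Type} [Zero M] {t : ℝ} {z z' : Config d n}
    (h : BackwardTrajectory ε t z z') (f : Config d n → M) : transport ε t f z = f z' := by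
  have hex : ∃ z', BackwardTrajectory ε t z z' := ⟨z', h⟩
  unfold transport
  rw [dif_pos hex, BackwardTrajectory.unique h0 h1 hex.choose_spec h]

lemma transport_eq_zero {M : Type} [Zero M] {t : ℝ} {z : Config d n}
    (h : ¬ ∃ z', BackwardTrajectory ε t z z') (f : Config d n → M) : transport ε t f z = 0 := by
  unfold transport
  rw [dif_neg h]

end Reach

/-! ### Lifting configurations to Euclidean space -/

section Lift

variable {d n : ℕ}

/-- Configurations with positions lifted to `ℝ^d`. -/
abbrev LiftConfig (d n : ℕ) : Type := Fin n → Vel d × Vel d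

instance : (volume : Measure (Vel d × Vel d)).IsAddHaarMeasure :=
  Measure.prod.instIsAddHaarMeasure _ _

instance : (volume : Measure (LiftConfig d n)).IsAddHaarMeasure :=
  Measure.pi.isAddHaarMeasure _

instance : (volume : Measure (LiftConfig d n × ℝ)).IsAddHaarMeasure :=
  Measure.prod.instIsAddHaarMeasure _ _

instance : (volume : Measure (LiftConfig d n × Vel d × Vel d)).IsAddHaarMeasure :=
  Measure.prod.instIsAddHaarMeasure _ _

instance : (volume : Measure (ℝ × LiftConfig d n × Vel d × Vel d)).IsAddHaarMeasure :=
  Measure.prod.instIsAddHaarMeasure _ _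

/-- The covering map from lifted configurations to configurations. -/
def proj (y : LiftConfig d n) : Config d n := fun i => (toTorus (y i).1, (y i).2)

lemma measurable_toTorus : Measurable (toTorus : Vel d → Torus d) :=
  continuous_toTorus.measurable

lemma measurable_proj : Measurable (proj : LiftConfig d n → Config d n) := by
  have := measurable_toTorus (d := d)
  unfold proj
  fun_prop

/-- A measurable section of the covering map `ℝ^d → 𝕋^d`. -/
def torusSection (x : Torus d) : Vel d :=
  WithLp.toLp 2 fun k => (AddCircle.measurableEquivIoc (1 : ℝ) 0 (x k) : ℝ)

lemma measurable_torusSection : Measurable (torusSection : Torus d → Vel d) := by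
  unfold torusSection
  refine (WithLp.measurable_toLp 2 (Fin d → ℝ)).comp (measurable_pi_lambda _ fun k => ?_)
  exact measurable_subtype_coe.comp
    ((AddCircle.measurableEquivIoc (1 : ℝ) 0).measurable.comp (measurable_pi_apply k))

lemma toTorus_torusSection (x : Torus d) : toTorus (torusSection x) = x := by
  funext k
  exact (AddCircle.measurableEquivIoc (1 : ℝ) 0).symm_apply_apply (x k)

/-- A measurable section of `proj`. -/
def configSection (z : Config d n) : LiftConfig d n := fun i => (torusSection (z i).1, (z i).2)

lemma measurable_configSection : Measurable (configSection : Config d n → LiftConfig d n) := by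
  have := measurable_torusSection (d := d)
  unfold configSection
  fun_prop

lemma proj_configSection (z : Config d n) : proj (configSection z) = z := by
  funext i
  simp [proj, configSection, toTorus_torusSection]

/-- The unit box `(0, 1]^d`. -/
def unitBox (d : ℕ) : Set (Vel d) := {u | ∀ k, u k ∈ Ioc (0 : ℝ) 1}

lemma measurePreserving_toTorus :
    MeasurePreserving (toTorus : Vel d → Torus d) (volume.restrict (unitBox d)) volume := by
  have h1 : MeasurePreserving (fun (a : Fin d → ℝ) (k : Fin d) => ((a k : ℝ) : UnitAddCircle))
      (Measure.pi fun _ => volume.restrict (Ioc (0 : ℝ) (0 + 1))) (Measure.pi fun _ => volume) :=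
    measurePreserving_pi _ _ fun _ => UnitAddCircle.measurePreserving_mk 0
  rw [← Measure.restrict_pi_pi] at h1
  have h2 := ((PiLp.volume_preserving_ofLp (Fin d)).restrict_preimage
    (MeasurableSet.univ_pi (t := fun _ : Fin d => Ioc (0 : ℝ) (0 + 1))
      fun _ => measurableSet_Ioc))
  have h3 := h1.comp h2
  have : unitBox d = (@WithLp.ofLp 2 (Fin d → ℝ)) ⁻¹' univ.pi fun _ => Ioc (0 : ℝ) (0 + 1) := by
    ext u; simp [unitBox]
  rw [this]
  exact h3

/-- The fundamental domain of the covering map `proj`. -/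
def fundBox (d n : ℕ) : Set (LiftConfig d n) := univ.pi fun _ => unitBox d ×ˢ univ

lemma measurePreserving_proj :
    MeasurePreserving (proj : LiftConfig d n → Config d n)
      (volume.restrict (fundBox d n)) volume := by
  have h1 : MeasurePreserving (Prod.map (toTorus : Vel d → Torus d) (id : Vel d → Vel d))
      ((volume : Measure (Vel d × Vel d)).restrict (unitBox d ×ˢ univ)) volume := by
    have := (measurePreserving_toTorus (d := d)).prod (MeasurePreserving.id (volume : Measure (Vel d)))
    rw [← Measure.restrict_univ (μ := (volume : Measure (Vel d))), Measure.prod_restrict] at this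
    rw [Measure.restrict_univ] at this
    exact this
  have := measurePreserving_pi _ _ fun _ : Fin n => h1
  rw [← Measure.restrict_pi_pi] at this
  exact this

/-- Translation of the positions by lattice vectors. -/
def latticeShift (l : Fin n → Fin d → ℤ) : LiftConfig d n := fun i => (lattice (l i), 0)

lemma proj_add_latticeShift (y : LiftConfig d n) (l : Fin n → Fin d → ℤ) :
    proj (y + latticeShift l) = proj y := by
  funext i
  refine Prod.ext (toTorus_eq_iff.2 ⟨l i, ?_⟩) ?_ <;> simp [proj, latticeShift]

lemma exists_add_latticeShift_mem (y : LiftConfig d n) :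
    ∃ l, y + latticeShift l ∈ fundBox d n := by
  -- Adding `1 - ⌈x⌉` moves `x` into the half-open interval `(0, 1]`.
  refine ⟨fun i k => 1 - ⌈(y i).1 k⌉, fun i _ => ⟨fun k => ?_, trivial⟩⟩
  have h1 := Int.le_ceil ((y i).1 k)
  have h2 := Int.ceil_lt_add_one ((y i).1 k)
  simp only [latticeShift, Pi.add_apply, Prod.fst_add, PiLp.add_apply, lattice_apply, mem_Ioc]
  push_cast
  constructor <;> linarith

/-- The preimage is invariant under lattice translations, so countably many translates of its part
in the fundamental box cover it. -/
lemma volume_proj_preimage_eq_zero {A : Set (Config d n)} (hA : volume A = 0) :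
    volume (proj ⁻¹' A) = 0 := by
  have h1 : volume.restrict (fundBox d n) (proj ⁻¹' A) = 0 :=
    (measurePreserving_proj).quasiMeasurePreserving.preimage_null hA
  have hbox : volume (proj ⁻¹' A ∩ fundBox d n) = 0 :=
    le_antisymm ((Measure.le_restrict_apply _ _).trans h1.le) zero_le
  have : proj ⁻¹' A ⊆ ⋃ l : Fin n → Fin d → ℤ,
      (fun y => y + latticeShift l) ⁻¹' (proj ⁻¹' A ∩ fundBox d n) := by
    intro y hy
    obtain ⟨l, hl⟩ := exists_add_latticeShift_mem y
    refine mem_iUnion.2 ⟨l, ?_, hl⟩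
    rw [mem_preimage, proj_add_latticeShift]
    exact hy
  refine measure_mono_null this (measure_iUnion_null fun l => ?_)
  rwa [measure_preimage_add_right]

lemma volume_eq_zero_of_proj {A : Set (Config d n)} (hm : MeasurableSet A)
    (h : volume (proj ⁻¹' A) = 0) : volume A = 0 := by
  rw [← measurePreserving_proj.measure_preimage hm.nullMeasurableSet]
  exact le_antisymm ((Measure.restrict_apply_le _ _).trans h.le) zero_le

lemma volume_absolutelyContinuous_map_proj :
    (volume : Measure (Config d n)) ≪ (volume : Measure (LiftConfig d n)).map proj := by
  refine Measure.AbsolutelyContinuous.mk fun A hA h => ?_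
  rw [Measure.map_apply measurable_proj hA] at h
  exact volume_eq_zero_of_proj hA h

end Lift

/-! ### Spherical measure and radial projection. -/

section Sphere

variable {d : ℕ}

open Classical in
/-- The radial projection onto the unit sphere, with a default value at the origin. -/
def normalize (ω₀ : Metric.sphere (0 : Vel d) 1) (u : Vel d) : Metric.sphere (0 : Vel d) 1 :=
  if h : ‖u‖⁻¹ • u ∈ Metric.sphere (0 : Vel d) 1 then ⟨‖u‖⁻¹ • u, h⟩ else ω₀

lemma normalize_coe (ω₀ : Metric.sphere (0 : Vel d) 1) {u : Vel d} (hu : u ≠ 0) :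
    (normalize ω₀ u : Vel d) = ‖u‖⁻¹ • u := by
  unfold normalize
  rw [dif_pos (by simp [norm_smul, hu])]

open Classical in
lemma measurable_normalize (ω₀ : Metric.sphere (0 : Vel d) 1) : Measurable (normalize ω₀) := by
  unfold normalize
  have h1 : Measurable fun u : Vel d => ‖u‖⁻¹ • u := by fun_prop
  have h2 : MeasurableSet {u : Vel d | ‖u‖⁻¹ • u ∈ Metric.sphere (0 : Vel d) 1} :=
    h1 Metric.isClosed_sphere.measurableSet
  refine Measurable.dite (s := {u : Vel d | ‖u‖⁻¹ • u ∈ Metric.sphere (0 : Vel d) 1})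
    (f := fun u => ⟨‖(u : Vel d)‖⁻¹ • (u : Vel d), u.2⟩) (g := fun _ => ω₀) ?_ measurable_const h2
  exact Measurable.subtype_mk (h1.comp measurable_subtype_coe)

/-- The spherical measure of `A` is a multiple of the volume of the cone `(0, 1)·A`, and that cone
projects radially into `A`. The sphere can thus be replaced by a linear space, where differentiable
maps are easier to handle. -/
lemma toSphere_absolutelyContinuous_map_normalize (ω₀ : Metric.sphere (0 : Vel d) 1) :
    (volume : Measure (Vel d)).toSphere ≪ (volume : Measure (Vel d)).map (normalize ω₀) := by
  refine Measure.AbsolutelyContinuous.mk fun A hA h => ?_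
  rw [Measure.map_apply (measurable_normalize ω₀) hA] at h
  rw [Measure.toSphere_apply' _ hA]
  have : Ioo (0 : ℝ) 1 • ((↑) '' A : Set (Vel d)) ⊆ normalize ω₀ ⁻¹' A := by
    rintro _ ⟨r, hr, _, ⟨ω, hω, rfl⟩, rfl⟩
    have hn : ‖(ω : Vel d)‖ = 1 := by simp
    have hne : r • (ω : Vel d) ≠ 0 := by
      rw [← norm_pos_iff, norm_smul, hn, mul_one, Real.norm_of_nonneg hr.1.le]; exact hr.1
    have : normalize ω₀ (r • (ω : Vel d)) = ω := by
      apply Subtype.ext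
      rw [normalize_coe _ hne, norm_smul, hn, mul_one, Real.norm_of_nonneg hr.1.le, smul_smul,
        inv_mul_cancel₀ hr.1.ne', one_smul]
    simp [this, hω]
  rw [measure_mono_null this h, mul_zero]

end Sphere

/-! ### Null sets: lifting, differentiable images, contacts and free flight. -/

section Null

variable {d n : ℕ} {ε : ℝ}

/-- A set of collision parameters `(t, z, ω, v)` is null if its lift is. -/
lemma collisionParam_null (hd : 0 < d) {W : Set (ℝ × Config d n × Metric.sphere (0 : Vel d) 1 × Vel d)}
    (hW : MeasurableSet W)
    (h : volume {q : ℝ × LiftConfig d n × Vel d × Vel d | q.2.2.1 ≠ 0 ∧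
      ∀ ω : Metric.sphere (0 : Vel d) 1, (ω : Vel d) = ‖q.2.2.1‖⁻¹ • q.2.2.1 →
        (q.1, proj q.2.1, ω, q.2.2.2) ∈ W} = 0) :
    (volume.prod (volume.prod (collisionMeasure d))) W = 0 := by
  have : Nonempty (Metric.sphere (0 : Vel d) 1) := by
    have : Nonempty (Fin d) := ⟨⟨0, hd⟩⟩
    exact (NormedSpace.sphere_nonempty (x := (0 : Vel d)) (r := 1)).2 zero_le_one |>.to_subtype
  obtain ⟨ω₀⟩ := this
  have hac : (volume : Measure ℝ).prod ((volume : Measure (Config d n)).prod (collisionMeasure d)) ≪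
      ((volume : Measure ℝ).map id).prod (((volume : Measure (LiftConfig d n)).map proj).prod
        (((volume : Measure (Vel d)).map (normalize ω₀)).prod ((volume : Measure (Vel d)).map id))) := by
    rw [Measure.map_id, Measure.map_id]
    exact Measure.AbsolutelyContinuous.rfl.prod (volume_absolutelyContinuous_map_proj.prod
      ((toSphere_absolutelyContinuous_map_normalize ω₀).prod Measure.AbsolutelyContinuous.rfl))
  refine hac ?_
  rw [Measure.map_prod_map _ _ (measurable_normalize ω₀) measurable_id,
    Measure.map_prod_map _ _ measurable_proj ((measurable_normalize ω₀).prodMap measurable_id),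
    Measure.map_prod_map _ _ measurable_id
      (measurable_proj.prodMap ((measurable_normalize ω₀).prodMap measurable_id)),
    Measure.map_apply (measurable_id.prodMap
      (measurable_proj.prodMap ((measurable_normalize ω₀).prodMap measurable_id))) hW]
  have h0 : volume {q : ℝ × LiftConfig d n × Vel d × Vel d | q.2.2.1 = 0} = 0 := by
    have hq : Measure.QuasiMeasurePreserving (fun q : ℝ × LiftConfig d n × Vel d × Vel d => q.2.2.1)
        volume volume :=
      Measure.quasiMeasurePreserving_fst.comp
        (Measure.quasiMeasurePreserving_snd.comp Measure.quasiMeasurePreserving_snd)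
    have : Nonempty (Fin d) := ⟨⟨0, hd⟩⟩
    exact hq.preimage_null (measure_singleton (0 : Vel d))
  refine measure_mono_null ?_ (measure_union_null h0 h)
  rintro ⟨t, y, u, v⟩ hq
  by_cases hu : u = 0
  · exact Or.inl hu
  · refine Or.inr ⟨hu, fun ω hω => ?_⟩
    have : normalize ω₀ u = ω := Subtype.ext (by rw [normalize_coe _ hu, hω])
    rw [← this]
    exact hq

/-- A linear isomorphism reduces this to self-maps of `E`. All additive Haar measures have the same
null sets, so the choice of isomorphism does not matter. -/
lemma image_null_of_differentiableOn {E F : Type*} [NormedAddCommGroup E] [NormedSpace ℝ E]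
    [FiniteDimensional ℝ E] [MeasurableSpace E] [BorelSpace E]
    [NormedAddCommGroup F] [NormedSpace ℝ F] [FiniteDimensional ℝ F] [MeasurableSpace F]
    [BorelSpace F] (μ : Measure E) [μ.IsAddHaarMeasure] (ν : Measure F) [ν.IsAddHaarMeasure]
    (hEF : Module.finrank ℝ E = Module.finrank ℝ F) {f : E → F} {s : Set E}
    (hf : DifferentiableOn ℝ f s) (hs : μ s = 0) : ν (f '' s) = 0 := by
  let e : F ≃L[ℝ] E := ContinuousLinearEquiv.ofFinrankEq hEF.symm
  have h1 : μ ((e ∘ f) '' s) = 0 :=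
    addHaar_image_eq_zero_of_differentiableOn_of_addHaar_eq_zero μ
      (e.differentiable.comp_differentiableOn hf) hs
  rw [image_comp, ← ContinuousLinearEquiv.coe_toHomeomorph, Homeomorph.image_eq_preimage_symm] at h1
  have h2 := (e.symm.isAddHaarMeasure_map μ)
  have h3 : (μ.map e.symm) (f '' s) = 0 := by
    rw [← ContinuousLinearEquiv.coe_toHomeomorph, ← Homeomorph.toMeasurableEquiv_coe,
      MeasurableEquiv.map_apply]
    exact h1
  exact (Measure.absolutelyContinuous_isAddHaarMeasure ν (μ.map e.symm)) h3

/-- Lifted to Euclidean space, such a state has a relative position on a sphere of radius `ε` about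
some lattice vector. Spheres are null, and so are their preimages under a surjective linear map. -/
lemma volume_closedDomain_diff_domain (hd : 0 < d) :
    volume (closedDomain d n ε \ domain d n ε) = 0 := by
  refine volume_eq_zero_of_proj
    (isClosed_closedDomain.measurableSet.diff isOpen_domain.measurableSet) ?_
  have hsub : proj ⁻¹' (closedDomain d n ε \ domain d n ε) ⊆
      ⋃ (i : Fin n) (j : Fin n) (_ : i ≠ j) (l : Fin d → ℤ),
        {y : LiftConfig d n | (y i).1 - (y j).1 ∈ Metric.sphere (lattice l) ε} := by
    rintro y ⟨hy1, hy2⟩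
    simp only [domain, mem_ofPred_eq, not_forall, not_lt] at hy2
    obtain ⟨i, j, hij, hle⟩ := hy2
    have heq := le_antisymm hle (hy1 i j hij)
    simp only [mem_iUnion]
    -- The nearest lattice point realises the flat distance.
    refine ⟨i, j, hij, fun k => round ((y i).1 k - (y j).1 k), ?_⟩
    rw [mem_ofPred_eq, mem_sphere_iff_norm, EuclideanSpace.norm_eq, ← heq]
    unfold torusDist
    congr 1
    refine Finset.sum_congr rfl fun k _ => ?_
    congr 1
    simp only [proj, toTorus]
    rw [← AddCircle.coe_sub, UnitAddCircle.norm_eq]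
    rfl
  refine measure_mono_null hsub ?_
  refine measure_iUnion_null fun i => measure_iUnion_null fun j => measure_iUnion_null fun hij =>
    measure_iUnion_null fun l => ?_
  let L : LiftConfig d n →ₗ[ℝ] Vel d :=
    (LinearMap.fst ℝ _ _ ∘ₗ LinearMap.proj i) - (LinearMap.fst ℝ _ _ ∘ₗ LinearMap.proj j)
  have hL : Function.Surjective L := fun u => by
    refine ⟨fun k => if k = i then (u, 0) else 0, ?_⟩
    simp [L, hij.symm]
  have := (ae_comp_linearMap_mem_iff L volume (volume : Measure (Vel d)) hL
    (s := (Metric.sphere (lattice l) ε)ᶜ) Metric.isClosed_sphere.measurableSet.compl).2 (by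
      rw [ae_iff]
      have : Nonempty (Fin d) := ⟨⟨0, hd⟩⟩
      have hs := Measure.addHaar_sphere (volume : Measure (Vel d)) (lattice l) ε
      convert hs using 2
      ext u
      simp)
  rw [ae_iff] at this
  simpa [L] using this

lemma measurePreserving_freeBack (t : ℝ) :
    MeasurePreserving (freeBack t : Config d n → Config d n) := by
  have h1 : MeasurePreserving (fun p : Torus d × Vel d => (p.1 - toTorus (t • p.2), p.2)) := by
    have h2 : MeasurePreserving (fun p : Vel d × Torus d => (p.1, p.2 - toTorus (t • p.1)))
        (volume.prod volume) (volume.prod volume) := by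
      refine MeasurePreserving.skew_product (g := fun v x => x - toTorus (t • v))
        (MeasurePreserving.id volume) ?_ (Filter.Eventually.of_forall fun v => ?_)
      · have := measurable_toTorus (d := d)
        unfold Function.uncurry
        fun_prop
      · exact (measurePreserving_sub_right volume _).map_eq
    exact Measure.measurePreserving_swap.comp (h2.comp Measure.measurePreserving_swap)
  exact volume_preserving_pi fun _ : Fin n => h1

end Null

/-! ### Collision times in lifted coordinates -/

section HitTime

variable {d n : ℕ}

/-- The reduced discriminant of the equation `‖a - τ b‖ = ε` for `τ`. -/
def hitDisc (ε : ℝ) (a b : Vel d) : ℝ := (inner ℝ a b) ^ 2 - ‖b‖ ^ 2 * (‖a‖ ^ 2 - ε ^ 2)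

/-- The smaller root `τ` of the equation `‖a - τ b‖ = ε`. -/
def hitTime (ε : ℝ) (a b : Vel d) : ℝ := (inner ℝ a b - √(hitDisc ε a b)) / ‖b‖ ^ 2

/-- The condition `hp` says that the distance is decreasing at `τ`, which selects the smaller root.
It also excludes grazing, hence a positive discriminant, and this is what makes `hitTime`
differentiable. -/
lemma hitTime_eq {ε τ : ℝ} {a b : Vel d} (h : ‖a - τ • b‖ = ε)
    (hp : 0 < inner ℝ (a - τ • b) b) : b ≠ 0 ∧ 0 < hitDisc ε a b ∧ hitTime ε a b = τ := by
  have hb : b ≠ 0 := by rintro rfl; simp at hp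
  have hb' : ‖b‖ ^ 2 ≠ 0 := by simpa using hb
  rw [inner_sub_left, real_inner_smul_left, real_inner_self_eq_norm_sq] at hp
  have hd : hitDisc ε a b = (inner ℝ a b - τ * ‖b‖ ^ 2) ^ 2 := by
    have h2 : ‖a - τ • b‖ ^ 2 = ε ^ 2 := by rw [h]
    rw [norm_sub_sq_real, real_inner_smul_right, norm_smul, mul_pow, Real.norm_eq_abs, sq_abs] at h2
    unfold hitDisc
    rw [← h2]
    ring
  refine ⟨hb, by rw [hd]; positivity, ?_⟩
  unfold hitTime
  rw [hd, Real.sqrt_sq hp.le]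
  field_simp
  ring

lemma measurable_hitTime (ε : ℝ) : Measurable fun p : Vel d × Vel d => hitTime ε p.1 p.2 := by
  unfold hitTime hitDisc
  fun_prop

lemma differentiableAt_hitTime (ε : ℝ) {p : Vel d × Vel d} (hb : p.2 ≠ 0)
    (hp : 0 < hitDisc ε p.1 p.2) :
    DifferentiableAt ℝ (fun p : Vel d × Vel d => hitTime ε p.1 p.2) p := by
  have hsq : ∀ q : Vel d × Vel d, DifferentiableAt ℝ (fun q : Vel d × Vel d => ‖q.2‖ ^ 2) q :=
    fun q => differentiableAt_snd.norm_sq ℝ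
  have hsq' : ∀ q : Vel d × Vel d, DifferentiableAt ℝ (fun q : Vel d × Vel d => ‖q.1‖ ^ 2) q :=
    fun q => differentiableAt_fst.norm_sq ℝ
  have hin : DifferentiableAt ℝ (fun q : Vel d × Vel d => (inner ℝ q.1 q.2 : ℝ)) p :=
    differentiableAt_fst.inner ℝ differentiableAt_snd
  have hdisc : DifferentiableAt ℝ (fun q : Vel d × Vel d => hitDisc ε q.1 q.2) p :=
    (hin.pow 2).sub ((hsq p).mul ((hsq' p).sub_const _))
  have hb' : ‖p.2‖ ^ 2 ≠ 0 := by simpa using hb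
  have hnum : DifferentiableAt ℝ
      (fun q : Vel d × Vel d => (inner ℝ q.1 q.2 : ℝ) - √(hitDisc ε q.1 q.2)) p :=
    hin.sub (hdisc.sqrt hp.ne')
  simp only [hitTime, div_eq_mul_inv]
  exact hnum.mul ((hsq p).fun_inv hb')

/-- Lift of `freeBack`. -/
def liftFree (τ : ℝ) (y : LiftConfig d n) : LiftConfig d n :=
  fun i => ((y i).1 - τ • (y i).2, (y i).2)

lemma proj_liftFree (τ : ℝ) (y : LiftConfig d n) : proj (liftFree τ y) = freeBack τ (proj y) := by
  funext i
  simp [proj, liftFree, freeBack, toTorus_sub]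

lemma liftFree_liftFree (a b : ℝ) (y : LiftConfig d n) :
    liftFree a (liftFree b y) = liftFree (a + b) y := by
  funext i
  simp only [liftFree, Prod.mk.injEq, and_true, add_smul]
  abel

lemma liftFree_zero (y : LiftConfig d n) : liftFree 0 y = y := by
  funext i
  simp [liftFree]

/-- The sign with which the exchanged momentum of the pair `(i, j)` acts on particle `k`. -/
def exchangeSign (i j k : Fin n) : ℝ := if k = i then -1 else if k = j then 1 else 0

/-- Lift of `scatter`, with the exchanged momentum multiplied by `β`. -/
def liftScatter (β : ℝ) (i j : Fin n) (ω : Vel d) (y : LiftConfig d n) : LiftConfig d n :=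
  fun k => ((y k).1, (y k).2 + (β * exchangeSign i j k * inner ℝ ((y i).2 - (y j).2) ω) • ω)

lemma proj_liftScatter_one (i j : Fin n) (ω : Vel d) (y : LiftConfig d n) :
    proj (liftScatter 1 i j ω y) = scatter i j ω (proj y) := by
  funext k
  unfold liftScatter scatter exchangeSign proj
  split_ifs with h1 h2 <;> simp_all [sub_eq_add_neg]

lemma liftScatter_zero (i j : Fin n) (ω : Vel d) (y : LiftConfig d n) :
    liftScatter 0 i j ω y = y := by
  funext k
  simp [liftScatter]

lemma relVel_liftScatter_one {i j : Fin n} (hij : i ≠ j) {ω : Vel d} (hω : ‖ω‖ = 1)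
    (y : LiftConfig d n) :
    (inner ℝ ((liftScatter 1 i j ω y i).2 - (liftScatter 1 i j ω y j).2) ω : ℝ)
      = - inner ℝ ((y i).2 - (y j).2) ω := by
  have h := inner_scatter hij hω (proj y)
  rw [← proj_liftScatter_one] at h
  exact h

lemma liftScatter_one_liftScatter_one {i j : Fin n} (hij : i ≠ j) {ω : Vel d} (hω : ‖ω‖ = 1)
    (y : LiftConfig d n) : liftScatter 1 i j ω (liftScatter 1 i j ω y) = y := by
  funext k
  have := relVel_liftScatter_one hij hω y
  refine Prod.ext rfl ?_
  change (liftScatter 1 i j ω y k).2 + (1 * exchangeSign i j k *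
    inner ℝ ((liftScatter 1 i j ω y i).2 - (liftScatter 1 i j ω y j).2) ω) • ω = (y k).2
  rw [this]
  simp [liftScatter]

/-- Relative position of the pair `(i, j)`, shifted by a lattice vector. -/
def relPos (i j : Fin n) (l : Fin d → ℤ) (y : LiftConfig d n) : Vel d :=
  (y i).1 - (y j).1 - lattice l

/-- Relative velocity of the pair `(i, j)`. -/
def relVel (i j : Fin n) (y : LiftConfig d n) : Vel d := (y i).2 - (y j).2

/-- The time after which the forward free flight from `w` brings the pair `(i, j)` into contact. -/
def fwdTime (ε : ℝ) (i j : Fin n) (l : Fin d → ℤ) (w : LiftConfig d n) : ℝ :=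
  hitTime ε (relPos i j l w) (-relVel i j w)

/-- The direction of the contact reached at `fwdTime`. -/
def fwdDir (ε : ℝ) (i j : Fin n) (l : Fin d → ℤ) (w : LiftConfig d n) : Vel d :=
  ε⁻¹ • (relPos i j l w + fwdTime ε i j l w • relVel i j w)

/-- The states from which the forward free flight leads to a non-grazing contact of `(i, j)`. -/
def fwdSet (ε : ℝ) (i j : Fin n) (l : Fin d → ℤ) : Set (LiftConfig d n) :=
  {w | -relVel i j w ≠ 0 ∧ 0 < hitDisc ε (relPos i j l w) (-relVel i j w)}

lemma relPos_liftFree (i j : Fin n) (l : Fin d → ℤ) (s : ℝ) (y : LiftConfig d n) :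
    relPos i j l (liftFree s y) = relPos i j l y - s • relVel i j y := by
  simp only [relPos, liftFree, relVel, smul_sub]
  abel

/-- For a pre-collisional contact `y`, the state `liftFree s y` determines both `s` and `ω`: the
forward flight from it is a backward flight with opposite velocities, and `hitTime_eq` applies. The
contact data thereby become differentiable functions of a later state of the backward trajectory. -/
lemma fwd_spec {ε : ℝ} (h0 : 0 < ε) {i j : Fin n} {l : Fin d → ℤ} {y : LiftConfig d n} {ω : Vel d}
    (hω : ‖ω‖ = 1) (hc : relPos i j l y = ε • ω) (hneg : (inner ℝ ω (relVel i j y) : ℝ) < 0)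
    (s : ℝ) : liftFree s y ∈ fwdSet ε i j l ∧ fwdTime ε i j l (liftFree s y) = s ∧
      fwdDir ε i j l (liftFree s y) = ω := by
  have hrv : relVel i j (liftFree s y) = relVel i j y := rfl
  have e : relPos i j l (liftFree s y) - s • -relVel i j (liftFree s y) = ε • ω := by
    rw [relPos_liftFree, hrv, hc]; simp
  obtain ⟨h1, h2, h3⟩ := hitTime_eq (ε := ε) (τ := s) (a := relPos i j l (liftFree s y))
    (b := -relVel i j (liftFree s y))
    (by rw [e, norm_smul, hω, Real.norm_of_nonneg h0.le, mul_one])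
    (by rw [e, hrv, inner_neg_right, real_inner_smul_left]; nlinarith)
  refine ⟨⟨h1, h2⟩, h3, ?_⟩
  have h3' : fwdTime ε i j l (liftFree s y) = s := h3
  rw [fwdDir, h3', ← sub_neg_eq_add, ← smul_neg, e, smul_smul, inv_mul_cancel₀ h0.ne', one_smul]

lemma differentiable_relPos (i j : Fin n) (l : Fin d → ℤ) :
    Differentiable ℝ (relPos i j l : LiftConfig d n → Vel d) := by
  unfold relPos; fun_prop

lemma differentiable_relVel (i j : Fin n) :
    Differentiable ℝ (relVel i j : LiftConfig d n → Vel d) := by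
  unfold relVel; fun_prop

lemma differentiableOn_fwdTime (ε : ℝ) (i j : Fin n) (l : Fin d → ℤ) :
    DifferentiableOn ℝ (fwdTime ε i j l) (fwdSet ε i j l) := by
  intro w hw
  have h1 := differentiableAt_hitTime ε (p := (relPos i j l w, -relVel i j w)) hw.1 hw.2
  have h2 : DifferentiableAt ℝ (fun w : LiftConfig d n => (relPos i j l w, -relVel i j w)) w :=
    (differentiable_relPos i j l w).prodMk (differentiable_relVel i j w).neg
  exact (h1.comp w h2).differentiableWithinAt

lemma differentiableOn_fwdDir (ε : ℝ) (i j : Fin n) (l : Fin d → ℤ) :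
    DifferentiableOn ℝ (fwdDir ε i j l) (fwdSet ε i j l) :=
  (((differentiable_relPos i j l).differentiableOn).add ((differentiableOn_fwdTime ε i j l).smul
    (differentiable_relVel i j).differentiableOn)).const_smul ε⁻¹

lemma differentiable_liftFree :
    Differentiable ℝ fun p : ℝ × LiftConfig d n => liftFree p.1 p.2 := by
  unfold liftFree; fun_prop

lemma differentiable_liftScatter (β : ℝ) (i j : Fin n) :
    Differentiable ℝ fun p : Vel d × LiftConfig d n => liftScatter β i j p.1 p.2 := by
  unfold liftScatter
  refine differentiable_pi.2 fun k => ?_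
  have h : Differentiable ℝ fun p : Vel d × LiftConfig d n =>
      (inner ℝ ((p.2 i).2 - (p.2 j).2) p.1 : ℝ) :=
    Differentiable.inner ℝ (by fun_prop) differentiable_fst
  fun_prop

/-- The state after the forward free flight from `w` to the contact of the pair `(i, j)`, followed by
an exchange of momentum multiplied by `β`. -/
def fwdContact (ε β : ℝ) (i j : Fin n) (l : Fin d → ℤ) (w : LiftConfig d n) : LiftConfig d n :=
  liftScatter β i j (fwdDir ε i j l w) (liftFree (-fwdTime ε i j l w) w)

lemma differentiableOn_fwdContact (ε β : ℝ) (i j : Fin n) (l : Fin d → ℤ) :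
    DifferentiableOn ℝ (fwdContact ε β i j l) (fwdSet ε i j l) :=
  (differentiable_liftScatter β i j).comp_differentiableOn
    ((differentiableOn_fwdDir ε i j l).prodMk (differentiable_liftFree.comp_differentiableOn
      ((differentiableOn_fwdTime ε i j l).neg.prodMk differentiableOn_id)))

lemma fwdContact_liftFree {ε : ℝ} (h0 : 0 < ε) {i j : Fin n} {l : Fin d → ℤ} {y : LiftConfig d n}
    {ω : Vel d} (hω : ‖ω‖ = 1) (hc : relPos i j l y = ε • ω)
    (hneg : (inner ℝ ω (relVel i j y) : ℝ) < 0) (s β : ℝ) :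
    fwdContact ε β i j l (liftFree s y) = liftScatter β i j ω y := by
  obtain ⟨-, h2, h3⟩ := fwd_spec h0 hω hc hneg s
  rw [fwdContact, h2, h3, liftFree_liftFree, neg_add_cancel, liftFree_zero]

end HitTime

/-! ### Measurability of the backward dynamics -/

section Measurability

variable {d n : ℕ} {ε : ℝ}

lemma measurable_freeBack_uncurry :
    Measurable fun p : ℝ × Config d n => freeBack p.1 p.2 :=
  continuous_freeBack_uncurry.measurable

/-- The quantifier over `σ` is uncountable. With `σ = pt` and `p` in a compact subinterval of `(0,
1)`, the bad set is the projection of a closed set along a compact factor, hence closed. Countably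
many such intervals exhaust `(0, 1)`. -/
lemma measurableSet_freeFlight : MeasurableSet
    {q : ℝ × Config d n | ∀ σ, 0 < σ → σ < q.1 → freeBack σ q.2 ∈ domain d n ε} := by
  let K : ℕ → Set ℝ := fun m => Icc (1 / ((m : ℝ) + 2)) (1 - 1 / ((m : ℝ) + 2))
  let S : ℕ → Set (ℝ × Config d n) := fun m =>
    Prod.snd '' {p : K m × (ℝ × Config d n) | freeBack ((p.1 : ℝ) * p.2.1) p.2.2 ∈ (domain d n ε)ᶜ}
  have hS : ∀ m, IsClosed (S m) := fun m => by
    have : CompactSpace (K m) := isCompact_iff_compactSpace.1 isCompact_Icc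
    refine isClosedMap_snd_of_compactSpace _ ?_
    refine (isOpen_domain.isClosed_compl).preimage (continuous_freeBack_uncurry.comp
      (f := fun p : K m × (ℝ × Config d n) => ((p.1 : ℝ) * p.2.1, p.2.2)) ?_)
    fun_prop
  have heq : {q : ℝ × Config d n | ∀ σ, 0 < σ → σ < q.1 → freeBack σ q.2 ∈ domain d n ε} =
      {q | q.1 ≤ 0} ∪ ⋂ m, (S m)ᶜ := by
    ext ⟨t, z⟩
    simp only [mem_union, mem_iInter, mem_compl_iff, S, mem_image, not_exists, not_and]
    constructor
    · intro h
      rcases le_or_gt t 0 with ht | ht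
      · exact Or.inl ht
      · refine Or.inr fun m p hp hpe => hp ?_
        rw [hpe]
        have h1 : (0 : ℝ) < 1 / ((m : ℝ) + 2) := by positivity
        refine h _ (mul_pos (h1.trans_le p.1.2.1) ht) ?_
        have := p.1.2.2
        exact mul_lt_of_lt_one_left ht (by linarith)
    · rintro (ht | h) σ hσ hσt
      · exact absurd (hσ.trans hσt) (not_lt.2 ht)
      · have ht : 0 < t := hσ.trans hσt
        by_contra hn
        have hu : 0 < σ / t := by positivity
        have hu1 : σ / t < 1 := (div_lt_one ht).2 hσt
        obtain ⟨m, hm⟩ := exists_nat_one_div_lt (lt_min hu (sub_pos.2 hu1))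
        rw [lt_min_iff] at hm
        have hle : 1 / ((m : ℝ) + 2) ≤ 1 / ((m : ℝ) + 1) := by gcongr; norm_num
        refine h m (⟨σ / t, ⟨by linarith, by linarith⟩⟩, (t, z)) ?_ rfl
        simp only [mem_ofPred_eq]
        rw [div_mul_cancel₀ _ ht.ne']
        exact hn
  rw [heq]
  exact (measurableSet_le measurable_fst measurable_const).union
    (MeasurableSet.iInter fun m => (hS m).measurableSet.compl)

/-- The candidate for the first backward collision time of the pair `(i, j)`. -/
def backTime (ε : ℝ) (i j : Fin n) (l : Fin d → ℤ) (y : LiftConfig d n) : ℝ :=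
  hitTime ε (relPos i j l y) (relVel i j y)

/-- The direction of the contact reached at `backTime`. -/
def backDir (ε : ℝ) (i j : Fin n) (l : Fin d → ℤ) (y : LiftConfig d n) : Vel d :=
  ε⁻¹ • (relPos i j l y - backTime ε i j l y • relVel i j y)

lemma measurable_relPos (i j : Fin n) (l : Fin d → ℤ) :
    Measurable (relPos i j l : LiftConfig d n → Vel d) :=
  (differentiable_relPos i j l).continuous.measurable

lemma measurable_relVel (i j : Fin n) : Measurable (relVel i j : LiftConfig d n → Vel d) :=
  (differentiable_relVel i j).continuous.measurable

lemma measurable_backTime (ε : ℝ) (i j : Fin n) (l : Fin d → ℤ) :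
    Measurable (backTime ε i j l : LiftConfig d n → ℝ) := by
  have h : Measurable fun y : LiftConfig d n => (relPos i j l y, relVel i j y) :=
    (measurable_relPos i j l).prodMk (measurable_relVel i j)
  have h2 := (measurable_hitTime ε).comp h
  exact h2

lemma measurable_backDir (ε : ℝ) (i j : Fin n) (l : Fin d → ℤ) :
    Measurable (backDir ε i j l : LiftConfig d n → Vel d) := by
  have h1 := measurable_relPos i j l
  have h2 := measurable_relVel (d := d) i j
  have h3 := measurable_backTime ε i j l
  unfold backDir
  fun_prop

lemma lift_contact {y : LiftConfig d n} {i j : Fin n} {ω : Vel d}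
    (h : (proj y i).1 = (proj y j).1 + toTorus (ε • ω)) : ∃ l, relPos i j l y = ε • ω := by
  change toTorus (y i).1 = toTorus (y j).1 + _ at h
  rw [← toTorus_add] at h
  obtain ⟨l, hl⟩ := toTorus_eq_iff.1 h
  exact ⟨l, by rw [relPos, hl]; abel⟩

lemma contact_of_relPos {y : LiftConfig d n} {i j : Fin n} {ω : Vel d} {l : Fin d → ℤ}
    (h : relPos i j l y = ε • ω) : (proj y i).1 = (proj y j).1 + toTorus (ε • ω) := by
  change toTorus (y i).1 = toTorus (y j).1 + _
  rw [← toTorus_add]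
  refine toTorus_eq_iff.2 ⟨l, ?_⟩
  rw [← h, relPos]
  abel

lemma measurableSet_others (i j : Fin n) : MeasurableSet {z : Config d n | ∀ k l, k ≠ l →
    s(k, l) ≠ s(i, j) → ε < torusDist (z k).1 (z l).1} := by
  have : {z : Config d n | ∀ k l, k ≠ l → s(k, l) ≠ s(i, j) → ε < torusDist (z k).1 (z l).1} =
      ⋂ (k) (l) (_ : k ≠ l) (_ : s(k, l) ≠ s(i, j)), {z | ε < torusDist (z k).1 (z l).1} := by
    ext z; simp only [mem_ofPred_eq, mem_iInter]
  rw [this]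
  exact MeasurableSet.iInter fun k => MeasurableSet.iInter fun l => MeasurableSet.iInter fun _ =>
    MeasurableSet.iInter fun _ =>
      (isOpen_lt continuous_const (continuous_torusDist_apply k l)).measurableSet

lemma measurable_scatter (i j : Fin n) :
    Measurable fun p : Vel d × Config d n => scatter i j p.1 p.2 := by
  refine measurable_pi_lambda _ fun k => ?_
  unfold scatter
  split_ifs <;> fun_prop

/-- The existential quantifiers over the collision time and direction are uncountable, but in lifted
coordinates both are measurable functions of the state once the pair and the lattice vector are
fixed. Only countable unions remain. -/
lemma measurableSet_reach (h0 : 0 < ε) {A : Set (Config d n)} (hA : MeasurableSet A) (k : ℕ) :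
    MeasurableSet (reach ε k A) := by
  induction k with
  | zero =>
    exact (measurableSet_le measurable_const measurable_fst).inter
      ((isClosed_closedDomain.measurableSet.preimage measurable_snd).inter
        (measurableSet_freeFlight.inter (hA.preimage measurable_freeBack_uncurry)))
  | succ k ih =>
    have heq : reach ε (k + 1) A = (fun q : ℝ × Config d n => (q.1, configSection q.2)) ⁻¹'
        {q : ℝ × LiftConfig d n | (q.1, proj q.2) ∈ reach ε (k + 1) A} := by
      ext q; simp [proj_configSection]
    rw [heq]
    refine MeasurableSet.preimage ?_
      (measurable_fst.prodMk (measurable_configSection.comp measurable_snd))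
    have heq2 : {q : ℝ × LiftConfig d n | (q.1, proj q.2) ∈ reach ε (k + 1) A} =
        ⋃ (i : Fin n) (j : Fin n) (_ : i ≠ j) (l : Fin d → ℤ), {q | 0 ≤ backTime ε i j l q.2 ∧
          backTime ε i j l q.2 < q.1 ∧
          (backTime ε i j l q.2, proj q.2) ∈
            {q : ℝ × Config d n | ∀ σ, 0 < σ → σ < q.1 → freeBack σ q.2 ∈ domain d n ε} ∧
          ‖backDir ε i j l q.2‖ = 1 ∧
          freeBack (backTime ε i j l q.2) (proj q.2) ∈ {z : Config d n | ∀ k l, k ≠ l →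
            s(k, l) ≠ s(i, j) → ε < torusDist (z k).1 (z l).1} ∧
          0 < inner ℝ (backDir ε i j l q.2) (relVel i j q.2) ∧
          (q.1 - backTime ε i j l q.2, scatter i j (backDir ε i j l q.2)
            (freeBack (backTime ε i j l q.2) (proj q.2))) ∈ reach ε k A} := by
      ext ⟨t, y⟩
      simp only [mem_iUnion, mem_ofPred_eq]
      constructor
      · rintro ⟨i, j, ω, τ, hτ, hr, hfree, hp, h⟩
        have hc := hp.contact
        rw [← proj_liftFree] at hc
        obtain ⟨l, hl⟩ := lift_contact hc
        rw [relPos_liftFree] at hl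
        have hp' : 0 < inner ℝ ω (relVel i j y) := hp.post
        obtain ⟨-, -, h3⟩ := hitTime_eq (ε := ε) (τ := τ) (a := relPos i j l y)
          (b := relVel i j y)
          (by rw [hl, norm_smul, hp.norm_eq, Real.norm_of_nonneg h0.le, mul_one])
          (by rw [hl, real_inner_smul_left]; positivity)
        have h3' : backTime ε i j l y = τ := h3
        have h4 : backDir ε i j l y = ω := by
          rw [backDir, h3', hl, smul_smul, inv_mul_cancel₀ h0.ne', one_smul]
        refine ⟨i, j, hp.ne, l, ?_⟩
        rw [h3', h4]
        exact ⟨hτ, hr, hfree, hp.norm_eq, hp.others, hp', h⟩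
      · rintro ⟨i, j, hij, l, hτ, hr, hfree, hω, ho, hp, h⟩
        refine ⟨i, j, backDir ε i j l y, backTime ε i j l y, hτ, hr, hfree, ⟨hij, hω, ?_, ho, hp⟩, h⟩
        simp only [← proj_liftFree]
        refine contact_of_relPos (l := l) ?_
        rw [relPos_liftFree, backDir, smul_smul, mul_inv_cancel₀ h0.ne', one_smul]
    rw [heq2]
    refine MeasurableSet.iUnion fun i => MeasurableSet.iUnion fun j => MeasurableSet.iUnion fun _ =>
      MeasurableSet.iUnion fun l => ?_
    have mT : Measurable fun q : ℝ × LiftConfig d n => backTime ε i j l q.2 :=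
      (measurable_backTime ε i j l).comp measurable_snd
    have mD : Measurable fun q : ℝ × LiftConfig d n => backDir ε i j l q.2 :=
      (measurable_backDir ε i j l).comp measurable_snd
    have mP : Measurable fun q : ℝ × LiftConfig d n => proj q.2 :=
      measurable_proj.comp measurable_snd
    have mF : Measurable fun q : ℝ × LiftConfig d n =>
        freeBack (backTime ε i j l q.2) (proj q.2) :=
      measurable_freeBack_uncurry.comp (mT.prodMk mP)
    have mV : Measurable fun q : ℝ × LiftConfig d n => relVel i j q.2 :=
      (measurable_relVel i j).comp measurable_snd
    have mS : Measurable fun q : ℝ × LiftConfig d n => scatter i j (backDir ε i j l q.2)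
        (freeBack (backTime ε i j l q.2) (proj q.2)) :=
      (measurable_scatter i j).comp (mD.prodMk mF)
    have mR : Measurable fun q : ℝ × LiftConfig d n => q.1 - backTime ε i j l q.2 :=
      measurable_fst.sub mT
    have mI : Measurable fun q : ℝ × LiftConfig d n =>
        (inner ℝ (backDir ε i j l q.2) (relVel i j q.2) : ℝ) := mD.inner mV
    exact (measurableSet_le measurable_const mT).inter <|
      (measurableSet_lt mT measurable_fst).inter <|
      (measurableSet_freeFlight.preimage (mT.prodMk mP)).inter <|
      (measurableSet_eq_fun mD.norm measurable_const).inter <|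
      ((measurableSet_others i j).preimage mF).inter <|
      (measurableSet_lt measurable_const mI).inter <|
      ih.preimage (mR.prodMk mS)

end Measurability

/-! ### Nonsingularity of the backward dynamics -/

section Nonsingular

variable {d n : ℕ} {ε : ℝ}

/-- A trajectory leaving a pre-collisional contact can be followed up to a rational remaining time
before its next collision. -/
lemma exists_rat_reach (h0 : 0 < ε) (h1 : ε < 1 / 2) {A : Set (Config d n)} {k : ℕ} {r : ℝ}
    {y : Config d n} {i j : Fin n} {ω : Vel d} (hr : 0 < r) (hij : i ≠ j) (hω : ‖ω‖ = 1)
    (hc : (y i).1 = (y j).1 + toTorus (ε • ω))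
    (hneg : (inner ℝ ω ((y i).2 - (y j).2) : ℝ) < 0) (h : (r, y) ∈ reach ε k A) :
    ∃ q : ℚ, ((q : ℝ), freeBack (r - q) y) ∈ reach ε k A := by
  rcases reach_advance hr h with ⟨_, k, l, ω', hp, -⟩ | ⟨δ, hδ, -, hs⟩
  · exact absurd hp (not_postContact_of_inner_neg h0 h1 hij hω hc hneg)
  · obtain ⟨q, hq1, hq2⟩ := exists_rat_btwn (sub_lt_self r hδ)
    refine ⟨q, ?_⟩
    have := (hs (r - q) (by linarith) (by linarith)).2
    rwa [sub_sub_cancel] at this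

/-- Just after its first collision the trajectory is stopped at a rational remaining time `q`, in a
state `w` which the induction hypothesis places in a null set. The initial state is a differentiable
function of `w`, so it lies in a null set too. -/
theorem volume_reach_eq_zero (h0 : 0 < ε) (h1 : ε < 1 / 2) {A : Set (Config d n)}
    (hAm : MeasurableSet A) (hA : volume A = 0) (k : ℕ) (t : ℝ) :
    volume {z | (t, z) ∈ reach ε k A} = 0 := by
  induction k generalizing t with
  | zero =>
    exact measure_mono_null (fun z hz => hz.2.2.2)
      ((measurePreserving_freeBack t).quasiMeasurePreserving.preimage_null hA)
  | succ k ih =>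
    refine volume_eq_zero_of_proj
      ((measurableSet_reach h0 hAm (k + 1)).preimage measurable_prodMk_left) ?_
    let B : ℚ → Set (Config d n) := fun q => {z | ((q : ℝ), z) ∈ reach ε k A}
    -- From `w`, fly forward to the contact, undo the reflection, which is an involution, and fly
    -- forward for the first flight time. That time is `t - q - fwdTime`, since `t` is fixed and
    -- `fwdTime` is the time spent between the contact and `w`.
    let Ψ : ℚ → Fin n → Fin n → (Fin d → ℤ) → LiftConfig d n → LiftConfig d n :=
      fun q i j l w => liftFree (-(t - q - fwdTime ε i j l w)) (fwdContact ε 1 i j l w)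
    have hsub : proj ⁻¹' {z | (t, z) ∈ reach ε (k + 1) A} ⊆
        ⋃ (q : ℚ) (i : Fin n) (j : Fin n) (l : Fin d → ℤ),
          Ψ q i j l '' (proj ⁻¹' B q ∩ fwdSet ε i j l) := by
      rintro y ⟨i, j, ω, τ, hτ, hr, hfree, hp, h⟩
      simp only [mem_iUnion]
      have hneg := hp.scatter_inner_neg
      have hc := hp.contact
      obtain ⟨q, hq⟩ := exists_rat_reach h0 h1 (sub_pos.2 hr) hp.ne hp.norm_eq
        (by rw [scatter_fst, scatter_fst]; exact hc) hneg h
      rw [← proj_liftFree] at hc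
      obtain ⟨l, hl⟩ := lift_contact hc
      set Y := liftScatter 1 i j ω (liftFree τ y) with hY
      have hYp : proj Y = scatter i j ω (freeBack τ (proj y)) := by
        rw [hY, proj_liftScatter_one, proj_liftFree]
      rw [← hYp, ← proj_liftFree] at hq
      rw [← hYp] at hneg
      have hl' : relPos i j l Y = ε • ω := hl
      obtain ⟨e1, e2, -⟩ := fwd_spec h0 hp.norm_eq hl' hneg (t - τ - q)
      refine ⟨q, i, j, l, liftFree (t - τ - q) Y, ⟨hq, e1⟩, ?_⟩
      simp only [Ψ]
      rw [e2, fwdContact_liftFree h0 hp.norm_eq hl' hneg, hY,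
        liftScatter_one_liftScatter_one hp.ne hp.norm_eq, liftFree_liftFree]
      ring_nf
      exact liftFree_zero y
    refine measure_mono_null hsub (measure_iUnion_null fun q => measure_iUnion_null fun i =>
      measure_iUnion_null fun j => measure_iUnion_null fun l => ?_)
    refine addHaar_image_eq_zero_of_differentiableOn_of_addHaar_eq_zero volume ?_
      (measure_mono_null inter_subset_left (volume_proj_preimage_eq_zero (ih q)))
    refine DifferentiableOn.mono ?_ inter_subset_right
    exact differentiable_liftFree.comp_differentiableOn
      (((differentiableOn_fwdTime ε i j l).const_sub _).neg.prodMk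
        (differentiableOn_fwdContact ε 1 i j l))

/-- Lift of `adjoin`. -/
def liftAdjoin (ε : ℝ) (y : LiftConfig d n) (i : Fin n) (ω v : Vel d) : LiftConfig d (n + 1) :=
  Fin.snoc (α := fun _ => Vel d × Vel d) y ((y i).1 + ε • ω, v)

lemma proj_liftAdjoin (y : LiftConfig d n) (i : Fin n) (ω v : Vel d) :
    proj (liftAdjoin ε y i ω v) = adjoin ε (proj y) i ω v := by
  funext k
  refine Fin.lastCases ?_ (fun k => ?_) k
  · simp [proj, liftAdjoin, adjoin, toTorus_add]
  · simp [proj, liftAdjoin, adjoin]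

lemma adjoin_last (z : Config d n) (i : Fin n) (ω v : Vel d) :
    adjoin ε z i ω v (Fin.last n) = ((z i).1 + toTorus (ε • ω), v) := by simp [adjoin]

lemma adjoin_castSucc (z : Config d n) (i k : Fin n) (ω v : Vel d) :
    adjoin ε z i ω v k.castSucc = z k := by simp [adjoin]

lemma measurable_adjoin (i : Fin n) :
    Measurable fun p : Config d n × Metric.sphere (0 : Vel d) 1 × Vel d =>
      adjoin ε p.1 i p.2.1 p.2.2 := by
  refine measurable_pi_lambda _ fun k => ?_
  refine Fin.lastCases ?_ (fun k => ?_) k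
  · simp only [adjoin_last]
    have := measurable_toTorus (d := d)
    fun_prop
  · simp only [adjoin_castSucc]
    fun_prop

/-- The collision parameters `(t, z, ω, v)` for which the backward trajectory of duration `t` from
`(z, x_i + ε ω, v)` ends in `A`, without those for which the contact is grazing. -/
def collisionReach (ε : ℝ) (i : Fin n) (A : Set (Config d (n + 1))) :
    Set (ℝ × Config d n × Metric.sphere (0 : Vel d) 1 × Vel d) :=
  {q | inner ℝ (q.2.2.1 : Vel d) (q.2.2.2 - (q.2.1 i).2) ≠ 0 ∧
    ∃ z' ∈ A, BackwardTrajectory ε q.1 (adjoin ε q.2.1 i q.2.2.1 q.2.2.2) z'}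

lemma measurableSet_collisionReach (h0 : 0 < ε) (i : Fin n) {A : Set (Config d (n + 1))}
    (hA : MeasurableSet A) : MeasurableSet (collisionReach ε i A) := by
  have m1 : Measurable fun q : ℝ × Config d n × Metric.sphere (0 : Vel d) 1 × Vel d =>
      (inner ℝ (q.2.2.1 : Vel d) (q.2.2.2 - (q.2.1 i).2) : ℝ) :=
    Measurable.inner (by fun_prop) (by fun_prop)
  have m2 : Measurable fun q : ℝ × Config d n × Metric.sphere (0 : Vel d) 1 × Vel d =>
      (q.1, adjoin ε q.2.1 i q.2.2.1 q.2.2.2) :=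
    measurable_fst.prodMk ((measurable_adjoin i).comp measurable_snd)
  have : collisionReach ε i A = {q | inner ℝ (q.2.2.1 : Vel d) (q.2.2.2 - (q.2.1 i).2) = (0 : ℝ)}ᶜ ∩
      (fun q => (q.1, adjoin ε q.2.1 i q.2.2.1 q.2.2.2)) ⁻¹' ⋃ k, reach ε k A := by
    ext q
    simp only [collisionReach, exists_backwardTrajectory_iff]
    rfl
  rw [this]
  exact (measurableSet_eq_fun m1 measurable_const).compl.inter
    ((MeasurableSet.iUnion fun k => measurableSet_reach h0 hA k).preimage m2)

/-- Collision parameters in terms of the state before the collision, which is reached in the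
remaining time `q`. -/
def collisionParam (ε β : ℝ) (i : Fin n) (q : ℚ) (p : LiftConfig d (n + 1) × ℝ) :
    ℝ × LiftConfig d n × Vel d × Vel d :=
  (q + fwdTime ε (Fin.last n) i.castSucc 0 p.1,
    fun k => fwdContact ε β (Fin.last n) i.castSucc 0 p.1 k.castSucc,
    p.2 • fwdDir ε (Fin.last n) i.castSucc 0 p.1,
    (fwdContact ε β (Fin.last n) i.castSucc 0 p.1 (Fin.last n)).2)

lemma differentiableOn_collisionParam (ε β : ℝ) (i : Fin n) (q : ℚ) :
    DifferentiableOn ℝ (collisionParam (d := d) ε β i q)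
      (fwdSet ε (Fin.last n) i.castSucc 0 ×ˢ univ) := by
  have hm : MapsTo Prod.fst (fwdSet (d := d) ε (Fin.last n) i.castSucc 0 ×ˢ (univ : Set ℝ))
      (fwdSet ε (Fin.last n) i.castSucc 0) := fun p hp => hp.1
  have h1 := (differentiableOn_fwdTime (d := d) ε (Fin.last n) i.castSucc 0).comp
    differentiableOn_fst hm
  have h2 := (differentiableOn_fwdDir (d := d) ε (Fin.last n) i.castSucc 0).comp
    differentiableOn_fst hm
  have h3 := (differentiableOn_fwdContact (d := d) ε β (Fin.last n) i.castSucc 0).comp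
    differentiableOn_fst hm
  have h4 := fun k => differentiableOn_pi.1 h3 k
  exact (h1.const_add _).prodMk ((differentiableOn_pi.2 fun k : Fin n => h4 k.castSucc).prodMk
    ((differentiableOn_snd.smul h2).prodMk (h4 (Fin.last n)).snd))

/-- Both sides have dimension `2d(n+1) + 1`: the real factor is the radius `‖u‖` of the vector that
stands for the direction `ω`. -/
lemma volume_image_collisionParam (β : ℝ) (i : Fin n) (q : ℚ) {B : Set (Config d (n + 1))}
    (hB : volume B = 0) :
    volume (collisionParam ε β i q ''
      ((proj ⁻¹' B ∩ fwdSet ε (Fin.last n) i.castSucc 0) ×ˢ univ)) = 0 := by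
  refine image_null_of_differentiableOn (volume : Measure (LiftConfig d (n + 1) × ℝ)) volume ?_
    ((differentiableOn_collisionParam ε β i q).mono
      (prod_mono_left inter_subset_right)) ?_
  · simp only [Module.finrank_prod, Module.finrank_pi_fintype, finrank_euclideanSpace,
      Fintype.card_fin, Finset.sum_const, Finset.card_univ, Module.finrank_self, smul_eq_mul]
    ring
  · rw [Measure.volume_eq_prod, Measure.prod_prod,
      measure_mono_null inter_subset_left (volume_proj_preimage_eq_zero hB), zero_mul]

/-- A non-grazing contact is either pre-collisional, and left at once by free flight (`β = 0`), or
post-collisional, and reflected first (`β = 1`). In both cases the trajectory then leaves a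
pre-collisional contact, and its state at a rational remaining time determines all parameters,
including the duration. Duration zero is put aside as a null set. -/
theorem collisionReach_null (hd : 0 < d) (h0 : 0 < ε) (h1 : ε < 1 / 2) (i : Fin n)
    {A : Set (Config d (n + 1))} (hAm : MeasurableSet A) (hA : volume A = 0) :
    (volume.prod (volume.prod (collisionMeasure d))) (collisionReach ε i A) = 0 := by
  refine collisionParam_null hd (measurableSet_collisionReach h0 i hAm) ?_
  let B : ℕ → ℚ → Set (Config d (n + 1)) := fun k q => {z | ((q : ℝ), z) ∈ reach ε k A}
  have hB : ∀ k q, volume (B k q) = 0 := fun k q => volume_reach_eq_zero h0 h1 hAm hA k q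
  have hz : volume {p : ℝ × LiftConfig d n × Vel d × Vel d | p.1 = 0} = 0 :=
    Measure.quasiMeasurePreserving_fst.preimage_null (measure_singleton (0 : ℝ))
  refine measure_mono_null (t := {p : ℝ × LiftConfig d n × Vel d × Vel d | p.1 = 0} ∪
    ⋃ (k : ℕ) (q : ℚ) (b : Bool), collisionParam ε (if b then 1 else 0) i q ''
      ((proj ⁻¹' B k q ∩ fwdSet ε (Fin.last n) i.castSucc 0) ×ˢ univ)) ?_
    (measure_union_null hz (measure_iUnion_null fun k => measure_iUnion_null fun q =>
      measure_iUnion_null fun b => volume_image_collisionParam _ i q (hB k q)))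
  rintro ⟨t, y, u, v⟩ ⟨hu, hq⟩
  simp only at hu hq
  set ω : Vel d := ‖u‖⁻¹ • u with hωdef
  have hω : ‖ω‖ = 1 := by rw [hωdef, norm_smul, norm_inv, norm_norm, inv_mul_cancel₀ (by simpa)]
  have huω : ‖u‖ • ω = u := by rw [hωdef, smul_smul, mul_inv_cancel₀ (by simpa), one_smul]
  obtain ⟨hne, hex⟩ := hq ⟨ω, by simpa using hω⟩ rfl
  simp only at hne hex
  obtain ⟨z', hz', hbt⟩ := hex
  rcases hbt.nonneg.eq_or_lt with ht | ht
  · exact Or.inl ht.symm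
  refine Or.inr ?_
  simp only [mem_iUnion]
  obtain ⟨k, hk⟩ := mem_iUnion.1 (exists_backwardTrajectory_iff.1 ⟨z', hz', hbt⟩)
  set Y := liftAdjoin ε y i ω v with hY
  rw [← proj_liftAdjoin, ← hY] at hk
  have hYl : Y (Fin.last n) = ((y i).1 + ε • ω, v) := by simp [hY, liftAdjoin]
  have hYc : ∀ k : Fin n, Y k.castSucc = y k := fun k => by simp [hY, liftAdjoin]
  have hij : Fin.last n ≠ i.castSucc := (Fin.castSucc_lt_last i).ne'
  have hrel : relPos (Fin.last n) i.castSucc 0 Y = ε • ω := by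
    rw [relPos, hYl, hYc]
    have : lattice (0 : Fin d → ℤ) = 0 := by ext; simp [lattice_apply]
    simp [this]
  have hvel : relVel (Fin.last n) i.castSucc Y = v - (y i).2 := by rw [relVel, hYl, hYc]
  have hne' : (inner ℝ ω (relVel (Fin.last n) i.castSucc Y) : ℝ) ≠ 0 := by rw [hvel]; exact hne
  have final : ∀ (k : ℕ) (b : Bool) (Y' : LiftConfig d (n + 1)),
      (t, proj Y') ∈ reach ε k A → relPos (Fin.last n) i.castSucc 0 Y' = ε • ω →
      (inner ℝ ω (relVel (Fin.last n) i.castSucc Y') : ℝ) < 0 →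
      liftScatter (if b then 1 else 0) (Fin.last n) i.castSucc ω Y' = Y →
      ∃ (k : ℕ) (q : ℚ) (b : Bool), (t, y, u, v) ∈ collisionParam ε (if b then 1 else 0) i q ''
        ((proj ⁻¹' B k q ∩ fwdSet ε (Fin.last n) i.castSucc 0) ×ˢ univ) := by
    intro k b Y' hr hp' hneg hsc
    obtain ⟨q, hq⟩ := exists_rat_reach h0 h1 ht hij hω (contact_of_relPos hp') hneg hr
    rw [← proj_liftFree] at hq
    obtain ⟨e1, e2, e3⟩ := fwd_spec h0 hω hp' hneg (t - q)
    refine ⟨k, q, b, (liftFree (t - q) Y', ‖u‖), ⟨⟨hq, e1⟩, trivial⟩, ?_⟩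
    simp only [collisionParam]
    rw [e2, e3, fwdContact_liftFree h0 hω hp' hneg, hsc, hYl, huω, add_sub_cancel]
    simp only [hYc]
  rcases lt_or_gt_of_ne hne' with hneg | hpos
  · exact final k false Y hk hrel hneg (liftScatter_zero _ _ _ _)
  · have hcont := contact_of_relPos hrel
    rcases reach_advance ht hk with ⟨m, a, b, ω', hp, hm⟩ | ⟨δ, hδ, -, hs⟩
    · have hsym : s(a, b) = s(Fin.last n, i.castSucc) := by
        by_contra hsym
        have := hp.others _ _ hij (Ne.symm hsym)
        rw [hcont, torusDist_contact h0 h1 hω] at this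
        exact lt_irrefl _ this
      have hm' : (t, scatter (Fin.last n) i.castSucc ω (proj Y)) ∈ reach ε m A := by
        rcases contact_unique h0 h1 hij hω hp.norm_eq hcont hp.contact hsym with
          ⟨rfl, rfl, rfl⟩ | ⟨rfl, rfl, rfl⟩
        · exact hm
        · rwa [scatter_symm hij] at hm
      rw [← proj_liftScatter_one] at hm'
      refine final m true _ hm' hrel ?_ (liftScatter_one_liftScatter_one hij hω Y)
      rw [real_inner_comm]
      have := relVel_liftScatter_one hij hω Y
      rw [real_inner_comm] at hpos
      change (inner ℝ ((liftScatter 1 (Fin.last n) i.castSucc ω Y (Fin.last n)).2 - _) ω : ℝ) < 0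
      exact this.trans_lt (neg_lt_zero.2 hpos)
    -- Free departure from a post-collisional contact is impossible, as the two spheres would
    -- overlap.
    · obtain ⟨δ', hδ', hn⟩ := exists_not_mem_domain_of_contact h0 hij hω hcont hpos
      have hmin := lt_min hδ hδ'
      have h2 := half_lt_self hmin
      exact absurd (hs _ (half_pos hmin) (h2.trans_le (min_le_left _ _))).1
        (hn _ (half_pos hmin) (h2.trans_le (min_le_right _ _)))

end Nonsingular

/-! ### Measurability of transport and of iterated collisions -/

section TransportMeasurable

variable {d n : ℕ} {ε : ℝ}

/-- The pairs `(t, z)` from which the backward trajectory is defined. -/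
def trajectoryDomain (ε : ℝ) : Set (ℝ × Config d n) :=
  {q | ∃ z', BackwardTrajectory ε q.1 q.2 z'}

open Classical in
/-- The endpoint of the backward trajectory, with a default value where it is not defined. -/
def endpoint (ε : ℝ) (q : ℝ × Config d n) : Config d n :=
  if h : ∃ z', BackwardTrajectory ε q.1 q.2 z' then h.choose else q.2

lemma endpoint_spec {q : ℝ × Config d n} (h : q ∈ trajectoryDomain ε) :
    BackwardTrajectory ε q.1 q.2 (endpoint ε q) := by
  have h' : ∃ z', BackwardTrajectory ε q.1 q.2 z' := h
  unfold endpoint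
  rw [dif_pos h']
  exact h'.choose_spec

lemma measurableSet_exists_trajectory (h0 : 0 < ε) {A : Set (Config d n)} (hA : MeasurableSet A) :
    MeasurableSet {q : ℝ × Config d n | ∃ z' ∈ A, BackwardTrajectory ε q.1 q.2 z'} := by
  simp only [exists_backwardTrajectory_iff]
  exact MeasurableSet.iUnion fun k => measurableSet_reach h0 hA k

lemma measurableSet_trajectoryDomain (h0 : 0 < ε) :
    MeasurableSet (trajectoryDomain ε : Set (ℝ × Config d n)) := by
  have := measurableSet_exists_trajectory (d := d) (n := n) h0 MeasurableSet.univ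
  simpa [trajectoryDomain] using this

lemma measurable_endpoint (h0 : 0 < ε) (h1 : ε < 1 / 2) :
    Measurable (endpoint ε : ℝ × Config d n → Config d n) := by
  intro A hA
  have : endpoint ε ⁻¹' A = {q : ℝ × Config d n | ∃ z' ∈ A, BackwardTrajectory ε q.1 q.2 z'} ∪
      ((trajectoryDomain ε)ᶜ ∩ Prod.snd ⁻¹' A) := by
    ext q
    by_cases hq : q ∈ trajectoryDomain ε
    · have hs := endpoint_spec hq
      simp only [mem_preimage, mem_union, mem_inter_iff, mem_compl_iff, hq, not_true, false_and,
        or_false]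
      exact ⟨fun h => ⟨_, h, hs⟩, fun ⟨z', hz', h⟩ => by rwa [hs.unique h0 h1 h]⟩
    · have he : endpoint ε q = q.2 := dif_neg hq
      have hq' : ¬ ∃ z' ∈ A, BackwardTrajectory ε q.1 q.2 z' := fun ⟨z', _, h⟩ => hq ⟨z', h⟩
      simp only [mem_preimage, mem_union, mem_inter_iff, mem_compl_iff, hq, not_false_eq_true,
        true_and, he]
      exact ⟨Or.inr, fun h => h.resolve_left hq'⟩
  rw [this]
  exact (measurableSet_exists_trajectory h0 hA).union
    ((measurableSet_trajectoryDomain h0).compl.inter (hA.preimage measurable_snd))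

open Classical in
lemma transport_eq_ite (h0 : 0 < ε) (h1 : ε < 1 / 2) {M : Type} [Zero M] (t : ℝ) (z : Config d n)
    (f : Config d n → M) : transport ε t f z =
      if (t, z) ∈ trajectoryDomain ε then f (endpoint ε (t, z)) else 0 := by
  split_ifs with h
  · exact transport_eq h0 h1 (endpoint_spec h) f
  · exact transport_eq_zero h f

lemma measurable_transport (h0 : 0 < ε) (h1 : ε < 1 / 2) {M X : Type} [Zero M] [MeasurableSpace M]
    [MeasurableSpace X] {F : X → Config d n → M} (hF : Measurable (Function.uncurry F))
    {a : X → ℝ} (ha : Measurable a) {c : X → Config d n} (hc : Measurable c) :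
    Measurable fun x => transport ε (a x) (F x) (c x) := by
  classical
  simp only [transport_eq_ite h0 h1]
  have hac : Measurable fun x => (a x, c x) := ha.prodMk hc
  refine Measurable.ite ((measurableSet_trajectoryDomain h0).preimage hac) ?_ measurable_const
  exact hF.comp (measurable_id.prodMk ((measurable_endpoint h0 h1).comp hac))

instance : SFinite (collisionMeasure d) := by
  unfold collisionMeasure; infer_instance

lemma measurable_collision (N : ℕ) {X : Type} [MeasurableSpace X] {F : X → Config d (n + 1) → ℝ}
    (hF : Measurable (Function.uncurry F)) :
    Measurable fun q : X × Config d n => collision d N ε n (F q.1) q.2 := by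
  unfold collision
  refine Measurable.const_mul (Finset.measurable_fun_sum _ fun i _ => ?_) _
  refine StronglyMeasurable.measurable (StronglyMeasurable.integral_prod_right
    (f := fun (q : X × Config d n) (p : Metric.sphere (0 : Vel d) 1 × Vel d) =>
      inner ℝ (p.1 : Vel d) (p.2 - (q.2 i).2) * F q.1 (adjoin ε q.2 i p.1 p.2)) ?_)
  refine Measurable.stronglyMeasurable (Measurable.mul (Measurable.inner ?_ ?_) ?_)
  · fun_prop
  · fun_prop
  · exact hF.comp (measurable_fst.fst.prodMk ((measurable_adjoin (ε := ε) i).comp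
      (measurable_fst.snd.prodMk measurable_snd)))

lemma init_cons {s : ℕ} (t : ℝ) (τ : Fin (s + 1) → ℝ) :
    Fin.init (Fin.cons t τ : Fin (s + 2) → ℝ) = Fin.cons t (Fin.init τ) := by
  funext k
  refine Fin.cases ?_ (fun k => ?_) k
  · simp [Fin.init]
  · simp only [Fin.init, Fin.cons_succ, ← Fin.succ_castSucc]

lemma chain_succ_cons {M : Type} [Zero M] (K : (m : ℕ) → (Config d (m + 1) → M) → Config d m → M)
    (n s : ℕ) (t : ℝ) (τ : Fin (s + 1) → ℝ) (f : Config d (n + (s + 1)) → M) :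
    chain ε K n (s + 1) (Fin.cons t τ) f = chain ε K n s (Fin.cons t (Fin.init τ))
      (transport ε ((Fin.cons t (Fin.init τ) : Fin (s + 1) → ℝ) (Fin.last s) - τ (Fin.last s))
        (K (n + s) f)) := by
  rw [← init_cons]
  rfl

lemma cons_last_succ {s : ℕ} (t : ℝ) (τ : Fin (s + 1) → ℝ) :
    (Fin.cons t τ : Fin (s + 2) → ℝ) (Fin.last (s + 1)) = τ (Fin.last s) := by
  rw [← Fin.succ_last, Fin.cons_succ]

/-- The parameter space `X` stores the times already used. Each induction step moves the last time
of the simplex into `X`, so that the innermost transport and collision form a new measurable family;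
`a` is the time at which the next transport stops. -/
lemma measurable_chain (h0 : 0 < ε) (h1 : ε < 1 / 2) {M : Type} [Zero M] [MeasurableSpace M]
    (K : (m : ℕ) → (Config d (m + 1) → M) → Config d m → M)
    (hK : ∀ (m : ℕ) (X : Type) [MeasurableSpace X] (F : X → Config d (m + 1) → M),
      Measurable (Function.uncurry F) → Measurable fun q : X × Config d m => K m (F q.1) q.2)
    (t : ℝ) (s : ℕ) {X : Type} [MeasurableSpace X] (F : X → Config d (n + s) → M)
    (hF : Measurable (Function.uncurry F)) (a : X → ℝ) (ha : Measurable a) :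
    Measurable fun p : (X × (Fin s → ℝ)) × Config d n =>
      chain ε K n s (Fin.cons t p.1.2) (transport ε
        ((Fin.cons t p.1.2 : Fin (s + 1) → ℝ) (Fin.last s) - a p.1.1) (F p.1.1)) p.2 := by
  induction s generalizing X with
  | zero =>
    simp only [chain]
    refine measurable_transport h0 h1 (F := fun p : (X × (Fin 0 → ℝ)) × Config d n => F p.1.1)
      ?_ ?_ measurable_snd
    · exact hF.comp (measurable_fst.fst.fst.prodMk measurable_snd)
    · exact measurable_const.sub (ha.comp measurable_fst.fst)
  | succ s ih =>
    have hF' : Measurable (Function.uncurry fun (x : X × ℝ) (z : Config d (n + s)) =>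
        K (n + s) (transport ε (x.2 - a x.1) (F x.1)) z) := by
      refine hK (n + s) (X × ℝ) (fun x => transport ε (x.2 - a x.1) (F x.1)) ?_
      refine measurable_transport h0 h1
        (F := fun q : (X × ℝ) × Config d (n + (s + 1)) => F q.1.1) ?_ ?_ measurable_snd
      · exact hF.comp (measurable_fst.fst.fst.prodMk measurable_snd)
      · exact measurable_fst.snd.sub (ha.comp measurable_fst.fst)
    have := ih _ hF' Prod.snd measurable_snd
    simp only [chain_succ_cons, cons_last_succ]
    refine this.comp (g := fun p : ((X × ℝ) × (Fin s → ℝ)) × Config d n => _)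
      (f := fun p : (X × (Fin (s + 1) → ℝ)) × Config d n =>
        (((p.1.1, p.1.2 (Fin.last s)), Fin.init p.1.2), p.2)) ?_
    have h1 : Measurable fun τ : Fin (s + 1) → ℝ => (Fin.init τ : Fin s → ℝ) :=
      measurable_pi_lambda _ fun k => measurable_pi_apply k.castSucc
    have h2 := h1.comp (measurable_fst.snd : Measurable fun p : (X × (Fin (s + 1) → ℝ)) × Config d n => p.1.2)
    exact ((measurable_fst.fst.prodMk ((measurable_pi_apply _).comp measurable_fst.snd)).prodMk
      h2).prodMk measurable_snd

end TransportMeasurable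

/-! ### Dependence on the almost everywhere class -/

section AlmostEverywhere

variable {d n : ℕ} {ε : ℝ}

lemma slice_null (hd : 0 < d) {E : Set (Config d n)} (hE : domainMeasure d n ε E = 0)
    (hEm : MeasurableSet E) : volume (E ∩ closedDomain d n ε) = 0 := by
  have h1 : volume (E ∩ domain d n ε) = 0 := by
    rwa [domainMeasure, Measure.restrict_apply hEm] at hE
  refine measure_mono_null ?_ (measure_union_null h1 (volume_closedDomain_diff_domain (ε := ε) hd))
  rintro z ⟨hz, hz'⟩
  by_cases hzd : z ∈ domain d n ε
  · exact Or.inl ⟨hz, hzd⟩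
  · exact Or.inr ⟨hz', hzd⟩

lemma ae_slice_null (hd : 0 < d) {X : Type} [MeasurableSpace X] {μ : Measure X} [SFinite μ]
    {E : Set (X × Config d n)} (hEm : MeasurableSet E)
    (hE : (μ.prod (domainMeasure d n ε)) E = 0) :
    ∀ᵐ x ∂μ, volume (Prod.mk x ⁻¹' E ∩ closedDomain d n ε) = 0 := by
  have : SFinite (domainMeasure d n ε) := by unfold domainMeasure; infer_instance
  filter_upwards [(Measure.measure_prod_null hEm).1 hE] with x hx
  exact slice_null hd hx (hEm.preimage measurable_prodMk_left)

/-- For each fixed parameter, a discrepancy occurs only where a trajectory ends in a null subset of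
the closed domain, and `volume_reach_eq_zero` applies to every number of collisions. -/
lemma transport_congr_ae (hd : 0 < d) (h0 : 0 < ε) (h1 : ε < 1 / 2) {M X : Type} [Zero M]
    [MeasurableSpace X] {μ : Measure X} [SFinite μ] {F G : X → Config d n → M}
    (hFG : ∀ᵐ q ∂μ.prod (domainMeasure d n ε), F q.1 q.2 = G q.1 q.2)
    {a : X → ℝ} (ha : Measurable a) :
    ∀ᵐ q ∂μ.prod (volume : Measure (Config d n)),
      transport ε (a q.1) (F q.1) q.2 = transport ε (a q.1) (G q.1) q.2 := by
  obtain ⟨E, hE, hEm, hEn⟩ := exists_measurable_superset_of_null hFG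
  have hmap : Measurable fun q : X × Config d n => (a q.1, q.2) :=
    (ha.comp measurable_fst).prodMk measurable_snd
  let S : Set (X × Config d n) := (fun q => (a q.1, q.2)) ⁻¹' trajectoryDomain ε ∩
    (fun q => (q.1, endpoint ε (a q.1, q.2))) ⁻¹' E
  have hSm : MeasurableSet S := ((measurableSet_trajectoryDomain h0).preimage hmap).inter
    (hEm.preimage (measurable_fst.prodMk ((measurable_endpoint h0 h1).comp hmap)))
  have hS : (μ.prod (volume : Measure (Config d n))) S = 0 := by
    rw [Measure.measure_prod_null hSm]
    filter_upwards [ae_slice_null hd hEm hEn] with x hx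
    have hm : MeasurableSet (Prod.mk x ⁻¹' E ∩ closedDomain d n ε) :=
      (hEm.preimage measurable_prodMk_left).inter isClosed_closedDomain.measurableSet
    refine measure_mono_null (t := ⋃ k, {z | (a x, z) ∈
      reach ε k (Prod.mk x ⁻¹' E ∩ closedDomain d n ε)}) ?_
      (measure_iUnion_null fun k => volume_reach_eq_zero h0 h1 hm hx k (a x))
    rintro z ⟨hz, hzE⟩
    have hs := endpoint_spec hz
    have hex : ∃ z' ∈ Prod.mk x ⁻¹' E ∩ closedDomain d n ε, BackwardTrajectory ε (a x) z z' :=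
      ⟨_, ⟨hzE, hs.mem_closedDomain⟩, hs⟩
    obtain ⟨k, hk⟩ := mem_iUnion.1 (exists_backwardTrajectory_iff.1 hex)
    exact mem_iUnion.2 ⟨k, hk⟩
  have hS' : ∀ᵐ q ∂μ.prod (volume : Measure (Config d n)), q ∉ S :=
    measure_eq_zero_iff_ae_notMem.1 hS
  filter_upwards [hS'] with q hq
  classical
  rw [transport_eq_ite h0 h1, transport_eq_ite h0 h1]
  split_ifs with hqd
  · by_contra hne
    exact hq ⟨hqd, hE hne⟩
  · rfl

/-- The time must be among the variables: at duration zero the transported function is evaluated on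
the contacts themselves. Grazing parameters are left out, since the kernel `ω·(v - v_i)` vanishes
there. -/
lemma collision_congr_ae (hd : 0 < d) (h0 : 0 < ε) (h1 : ε < 1 / 2) {M X : Type} [Zero M]
    [MeasurableSpace X] {μ : Measure X} [SFinite μ] {F G : X → Config d (n + 1) → M}
    (hFG : ∀ᵐ q ∂μ.prod (domainMeasure d (n + 1) ε), F q.1 q.2 = G q.1 q.2)
    {a : X → ℝ} (ha : Measurable a) (i : Fin n) :
    ∀ᵐ q ∂(μ.prod (volume : Measure ℝ)).prod (volume : Measure (Config d n)),
      ∀ᵐ p ∂collisionMeasure d, inner ℝ (p.1 : Vel d) (p.2 - (q.2 i).2) ≠ (0 : ℝ) →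
        transport ε (q.1.2 - a q.1.1) (F q.1.1) (adjoin ε q.2 i p.1 p.2) =
          transport ε (q.1.2 - a q.1.1) (G q.1.1) (adjoin ε q.2 i p.1 p.2) := by
  obtain ⟨E, hE, hEm, hEn⟩ := exists_measurable_superset_of_null hFG
  let Y := X × (ℝ × (Config d n × (Metric.sphere (0 : Vel d) 1 × Vel d)))
  have m1 : Measurable fun q : Y =>
      (inner ℝ (q.2.2.2.1 : Vel d) (q.2.2.2.2 - (q.2.2.1 i).2) : ℝ) :=
    Measurable.inner (by fun_prop) (by fun_prop)
  have m2 : Measurable fun q : Y => (q.2.1 - a q.1, adjoin ε q.2.2.1 i q.2.2.2.1 q.2.2.2.2) :=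
    (measurable_snd.fst.sub (ha.comp measurable_fst)).prodMk
      ((measurable_adjoin i).comp measurable_snd.snd)
  let S : Set Y := {q | inner ℝ (q.2.2.2.1 : Vel d) (q.2.2.2.2 - (q.2.2.1 i).2) = (0 : ℝ)}ᶜ ∩
    ((fun q => (q.2.1 - a q.1, adjoin ε q.2.2.1 i q.2.2.2.1 q.2.2.2.2)) ⁻¹' trajectoryDomain ε ∩
    (fun q => (q.1, endpoint ε (q.2.1 - a q.1, adjoin ε q.2.2.1 i q.2.2.2.1 q.2.2.2.2))) ⁻¹' E)
  have hSm : MeasurableSet S := (measurableSet_eq_fun m1 measurable_const).compl.inter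
    (((measurableSet_trajectoryDomain h0).preimage m2).inter
      (hEm.preimage (measurable_fst.prodMk ((measurable_endpoint h0 h1).comp m2))))
  have hS : (μ.prod ((volume : Measure ℝ).prod ((volume : Measure (Config d n)).prod
      (collisionMeasure d)))) S = 0 := by
    rw [Measure.measure_prod_null hSm]
    filter_upwards [ae_slice_null hd hEm hEn] with x hx
    have hm : MeasurableSet (Prod.mk x ⁻¹' E ∩ closedDomain d (n + 1) ε) :=
      (hEm.preimage measurable_prodMk_left).inter isClosed_closedDomain.measurableSet
    have hnull := collisionReach_null hd h0 h1 i hm hx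
    have hshift := ((measurePreserving_sub_right (volume : Measure ℝ) (a x)).prod
      (MeasurePreserving.id ((volume : Measure (Config d n)).prod
        (collisionMeasure d)))).quasiMeasurePreserving.preimage_null hnull
    refine measure_mono_null ?_ hshift
    rintro ⟨τ, z, ω, v⟩ ⟨hne, hz, hzE⟩
    have hs := endpoint_spec hz
    exact ⟨hne, _, ⟨hzE, hs.mem_closedDomain⟩, hs⟩
  have hS' : ∀ᵐ q ∂(μ.prod ((volume : Measure ℝ).prod ((volume : Measure (Config d n)).prod
      (collisionMeasure d)))), q ∉ S := measure_eq_zero_iff_ae_notMem.1 hS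
  have mp1 := measurePreserving_prodAssoc (μ.prod (volume : Measure ℝ))
    (volume : Measure (Config d n)) (collisionMeasure d)
  have mp2 := measurePreserving_prodAssoc μ (volume : Measure ℝ)
    ((volume : Measure (Config d n)).prod (collisionMeasure d))
  have hS'' := Measure.ae_ae_of_ae_prod ((mp2.comp mp1).quasiMeasurePreserving.ae hS')
  filter_upwards [hS''] with q hq
  filter_upwards [hq] with p hp hne
  classical
  rw [transport_eq_ite h0 h1, transport_eq_ite h0 h1]
  split_ifs with hqd
  · by_contra hne'
    exact hp ⟨hne, hqd, hE hne'⟩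
  · rfl

lemma measurePreserving_splitLast {X : Type} [MeasurableSpace X] (μ : Measure X) [SFinite μ]
    (s : ℕ) : MeasurePreserving
      (fun p : X × (Fin (s + 1) → ℝ) => ((p.1, p.2 (Fin.last s)), (Fin.init p.2 : Fin s → ℝ)))
      (μ.prod volume) ((μ.prod volume).prod volume) := by
  have h1 : MeasurePreserving (fun τ : Fin (s + 1) → ℝ => (τ (Fin.last s), (Fin.init τ : Fin s → ℝ)))
      volume (volume.prod volume) := by
    have := volume_preserving_piFinSuccAbove (fun _ : Fin (s + 1) => ℝ) (Fin.last s)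
    have e : (fun τ : Fin (s + 1) → ℝ => (τ (Fin.last s), (Fin.init τ : Fin s → ℝ))) =
        MeasurableEquiv.piFinSuccAbove (fun _ : Fin (s + 1) => ℝ) (Fin.last s) := by
      funext τ
      refine Prod.ext rfl ?_
      funext k
      simp [MeasurableEquiv.piFinSuccAbove, Fin.init, Fin.insertNthEquiv]
    rw [e]
    exact this
  have h2 := (measurePreserving_prodAssoc μ (volume : Measure ℝ)
    (volume : Measure (Fin s → ℝ))).symm
  exact h2.comp ((MeasurePreserving.id μ).prod h1)

/-- The abstract `K` covers the signed and the absolute operators at once. One induction step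
transfers almost everywhere equality through a transport and a collision, the last time joining the
parameters. -/
theorem chain_congr_ae (hd : 0 < d) (h0 : 0 < ε) (h1 : ε < 1 / 2) {M : Type} [Zero M]
    (K : (m : ℕ) → (Config d (m + 1) → M) → Config d m → M)
    (hK : ∀ (m : ℕ) (f g : Config d (m + 1) → M) (z : Config d m),
      (∀ i, ∀ᵐ p ∂collisionMeasure d, inner ℝ (p.1 : Vel d) (p.2 - (z i).2) ≠ (0 : ℝ) →
        f (adjoin ε z i p.1 p.2) = g (adjoin ε z i p.1 p.2)) → K m f z = K m g z)
    (t : ℝ) (s : ℕ) {X : Type} [MeasurableSpace X] (μ : Measure X) [SFinite μ]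
    (F G : X → Config d (n + s) → M)
    (hFG : ∀ᵐ q ∂μ.prod (domainMeasure d (n + s) ε), F q.1 q.2 = G q.1 q.2)
    (a : X → ℝ) (ha : Measurable a) :
    ∀ᵐ p ∂(μ.prod (volume : Measure (Fin s → ℝ))).prod (volume : Measure (Config d n)),
      chain ε K n s (Fin.cons t p.1.2) (transport ε
        ((Fin.cons t p.1.2 : Fin (s + 1) → ℝ) (Fin.last s) - a p.1.1) (F p.1.1)) p.2 =
      chain ε K n s (Fin.cons t p.1.2) (transport ε
        ((Fin.cons t p.1.2 : Fin (s + 1) → ℝ) (Fin.last s) - a p.1.1) (G p.1.1)) p.2 := by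
  induction s generalizing X with
  | zero =>
    have h := transport_congr_ae hd h0 h1 hFG (a := fun x => t - a x) (measurable_const.sub ha)
    have hq : Measure.QuasiMeasurePreserving
        (Prod.map Prod.fst id : (X × (Fin 0 → ℝ)) × Config d n → X × Config d n)
        ((μ.prod volume).prod volume) (μ.prod volume) :=
      QuasiMeasurePreserving.prodMap Measure.quasiMeasurePreserving_fst
        (Measure.QuasiMeasurePreserving.id _)
    exact hq.ae h
  | succ s ih =>
    have hF' : ∀ᵐ q ∂(μ.prod (volume : Measure ℝ)).prod (domainMeasure d (n + s) ε),
        K (n + s) (transport ε (q.1.2 - a q.1.1) (F q.1.1)) q.2 =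
          K (n + s) (transport ε (q.1.2 - a q.1.1) (G q.1.1)) q.2 := by
      have hall := ae_all_iff.2 fun i => collision_congr_ae (n := n + s) hd h0 h1 hFG ha i
      have hac : (μ.prod (volume : Measure ℝ)).prod (domainMeasure d (n + s) ε) ≪
          (μ.prod (volume : Measure ℝ)).prod volume :=
        Measure.AbsolutelyContinuous.rfl.prod Measure.restrict_le_self.absolutelyContinuous
      filter_upwards [hac.ae_le hall] with q hq
      exact hK _ _ _ _ hq
    have := ih (μ.prod (volume : Measure ℝ))
      (fun x => K (n + s) (transport ε (x.2 - a x.1) (F x.1)))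
      (fun x => K (n + s) (transport ε (x.2 - a x.1) (G x.1))) hF' Prod.snd measurable_snd
    simp only [chain_succ_cons, cons_last_succ]
    exact ((measurePreserving_splitLast μ s).prod
      (MeasurePreserving.id (volume : Measure (Config d n)))).quasiMeasurePreserving.ae this

theorem chain_congr_ae_ae (hd : 0 < d) (h0 : 0 < ε) (h1 : ε < 1 / 2) {M : Type} [Zero M]
    (K : (m : ℕ) → (Config d (m + 1) → M) → Config d m → M)
    (hK : ∀ (m : ℕ) (f g : Config d (m + 1) → M) (z : Config d m),
      (∀ i, ∀ᵐ p ∂collisionMeasure d, inner ℝ (p.1 : Vel d) (p.2 - (z i).2) ≠ (0 : ℝ) →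
        f (adjoin ε z i p.1 p.2) = g (adjoin ε z i p.1 p.2)) → K m f z = K m g z)
    (t : ℝ) (s : ℕ) {f g : Config d (n + s) → M} (hfg : f =ᵐ[domainMeasure d (n + s) ε] g) :
    ∀ᵐ z ∂(volume : Measure (Config d n)), ∀ᵐ τ ∂(volume : Measure (Fin s → ℝ)),
      chain ε K n s (Fin.cons t τ)
        (transport ε ((Fin.cons t τ : Fin (s + 1) → ℝ) (Fin.last s)) f) z =
      chain ε K n s (Fin.cons t τ)
        (transport ε ((Fin.cons t τ : Fin (s + 1) → ℝ) (Fin.last s)) g) z := by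
  have : SFinite (domainMeasure d (n + s) ε) := by unfold domainMeasure; infer_instance
  have h := chain_congr_ae (n := n) hd h0 h1 K hK t s (Measure.dirac ()) (fun _ => f) (fun _ => g)
    (Measure.quasiMeasurePreserving_snd.ae hfg) (fun _ => 0) measurable_const
  have h2 := Measure.ae_ae_of_ae_prod (Measure.measurePreserving_swap.quasiMeasurePreserving.ae h)
  filter_upwards [h2] with z hz
  rw [Measure.dirac_prod] at hz
  have h3 := ae_of_ae_map (by fun_prop) hz
  simpa using h3

end AlmostEverywhere

/-! ### Pointwise bounds with Gaussian weights -/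

section Bounds

variable {d n : ℕ} {ε : ℝ}

/-- The Gaussian weight `exp (-μ H)`. -/
def gauss (μ : ℝ) (z : Config d n) : ℝ≥0∞ := ENNReal.ofReal (Real.exp (-(μ * kineticEnergy z)))

lemma kineticEnergy_nonneg (z : Config d n) : 0 ≤ kineticEnergy z := by
  unfold kineticEnergy; positivity

lemma kineticEnergy_adjoin (z : Config d n) (i : Fin n) (ω v : Vel d) :
    kineticEnergy (adjoin ε z i ω v) = kineticEnergy z + ‖v‖ ^ 2 / 2 := by
  unfold kineticEnergy
  rw [Fin.sum_univ_castSucc]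
  simp only [adjoin_last, adjoin_castSucc]
  ring

lemma transport_le_gauss {g : Config d n → ℝ≥0∞} {c : ℝ≥0∞} {μ : ℝ}
    (hg : ∀ z, g z ≤ c * gauss μ z) (t : ℝ) (z : Config d n) :
    transport ε t g z ≤ c * gauss μ z := by
  unfold transport
  split_ifs with h
  · have he := h.choose_spec.kineticEnergy_eq
    refine (hg _).trans ?_
    unfold gauss
    rw [he]
  · exact zero_le

lemma lintegral_gauss (a : ℝ) (ha : 0 ≤ a) {lam : ℝ} (hlam : 0 < lam) :
    ∫⁻ p : Metric.sphere (0 : Vel d) 1 × Vel d,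
        ENNReal.ofReal (a * Real.exp (-(lam / 8) * ‖p.2‖ ^ 2)) ∂collisionMeasure d =
      ENNReal.ofReal ((volume : Measure (Vel d)).toSphere.real univ * (Real.pi / (lam / 8)) ^ ((d : ℝ) / 2) * a) := by
  have hint := GaussianFourier.integral_rexp_neg_mul_sq_norm (V := Vel d) (b := lam / 8) (by positivity)
  rw [finrank_euclideanSpace, Fintype.card_fin] at hint
  have hI : Integrable fun v : Vel d => Real.exp (-(lam / 8) * ‖v‖ ^ 2) := by
    -- A non-integrable function would have integral zero by convention, against the positive value
    -- in `hint`.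
    by_contra hI
    rw [integral_undef hI] at hint
    have : 0 < (Real.pi / (lam / 8)) ^ ((d : ℝ) / 2) := by positivity
    linarith
  unfold collisionMeasure
  rw [lintegral_prod _ (by fun_prop)]
  simp only
  rw [lintegral_const, ← ofReal_integral_eq_lintegral_ofReal (hI.const_mul a)
    (Filter.Eventually.of_forall fun v => by positivity), integral_const_mul, hint,
    ← ofReal_measureReal, ← ENNReal.ofReal_mul (by positivity)]
  congr 1
  ring

lemma mul_exp_le {lam x : ℝ} (hlam : 0 < lam) : x * Real.exp (-(lam / 8) * x ^ 2) ≤ 4 / √lam := by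
  have hs : 0 < √lam := Real.sqrt_pos.2 hlam
  have hs2 : √lam ^ 2 = lam := Real.sq_sqrt hlam.le
  have h1 := Real.add_one_le_exp (lam / 8 * x ^ 2)
  rw [neg_mul, Real.exp_neg, ← div_eq_mul_inv, div_le_div_iff₀ (Real.exp_pos _) hs]
  have h2 : x * √lam ≤ 4 * (lam / 8 * x ^ 2 + 1) := by
    nlinarith [sq_nonneg (√lam * x - 1)]
  linarith

/-- By Cauchy–Schwarz `(∑ |v_i|)² ≤ 2nH`, and `2δH ≤ exp(2δH)`. This is the only place where part of
the weight is given up. -/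
lemma sum_norm_mul_exp_le (z : Config d n) {δ : ℝ} (hδ : 0 < δ) :
    (∑ i, ‖(z i).2‖) * Real.exp (-(δ * kineticEnergy z)) ≤ √(n / δ) := by
  apply Real.le_sqrt_of_sq_le
  have h1 := sq_sum_le_card_mul_sum_sq (s := (Finset.univ : Finset (Fin n)))
    (f := fun i => ‖(z i).2‖)
  have h2 : ∑ i, ‖(z i).2‖ ^ 2 = 2 * kineticEnergy z := by unfold kineticEnergy; ring
  rw [h2, Finset.card_univ, Fintype.card_fin] at h1
  have hH := kineticEnergy_nonneg z
  set H := kineticEnergy z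
  have h3 := Real.add_one_le_exp (2 * δ * H)
  rw [mul_pow, ← Real.exp_nat_mul, mul_neg, Real.exp_neg, ← div_eq_mul_inv,
    div_le_div_iff₀ (Real.exp_pos _) hδ]
  push_cast
  rw [← mul_assoc]
  have hn : (0 : ℝ) ≤ n := n.cast_nonneg
  nlinarith [mul_le_mul_of_nonneg_right h1 hδ.le, mul_le_mul_of_nonneg_left h3 hn]

/-- Since `μ ≥ lam/2`, the weight is at most the square of `exp(-(lam/8)|v|²)`. One factor absorbs
`|v|`, the other remains for the integration. -/
lemma norm_integrand_le {μ lam : ℝ} (hlam : 0 < lam) (hμ : lam / 2 ≤ μ) {ω : Vel d} (hω : ‖ω‖ = 1)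
    (v w : Vel d) : |inner ℝ ω (v - w)| * Real.exp (-(μ * (‖v‖ ^ 2 / 2))) ≤
      (4 / √lam + ‖w‖) * Real.exp (-(lam / 8) * ‖v‖ ^ 2) := by
  have h1 : |inner ℝ ω (v - w)| ≤ ‖v‖ + ‖w‖ := by
    refine (abs_real_inner_le_norm _ _).trans ?_
    rw [hω, one_mul]
    exact norm_sub_le v w
  have h2 : Real.exp (-(μ * (‖v‖ ^ 2 / 2))) ≤
      Real.exp (-(lam / 8) * ‖v‖ ^ 2) * Real.exp (-(lam / 8) * ‖v‖ ^ 2) := by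
    rw [← Real.exp_add]
    apply Real.exp_le_exp.2
    nlinarith [sq_nonneg ‖v‖]
  have h3 : Real.exp (-(lam / 8) * ‖v‖ ^ 2) ≤ 1 := Real.exp_le_one_iff.2 (by
    have : 0 ≤ lam / 8 * ‖v‖ ^ 2 := by positivity
    linarith)
  have h4 := mul_exp_le (x := ‖v‖) hlam
  calc |inner ℝ ω (v - w)| * Real.exp (-(μ * (‖v‖ ^ 2 / 2)))
      ≤ (‖v‖ + ‖w‖) * (Real.exp (-(lam / 8) * ‖v‖ ^ 2) * Real.exp (-(lam / 8) * ‖v‖ ^ 2)) := by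
        gcongr
    _ = (‖v‖ * Real.exp (-(lam / 8) * ‖v‖ ^ 2) + ‖w‖ * Real.exp (-(lam / 8) * ‖v‖ ^ 2)) *
          Real.exp (-(lam / 8) * ‖v‖ ^ 2) := by ring
    _ ≤ (4 / √lam + ‖w‖ * 1) * Real.exp (-(lam / 8) * ‖v‖ ^ 2) := by gcongr
    _ = _ := by rw [mul_one]

/-- The norm of one collision operator, with a loss `δ` in the Gaussian weight. -/
def collisionBound (d m : ℕ) (lam δ : ℝ) : ℝ :=
  (volume : Measure (Vel d)).toSphere.real univ * (Real.pi / (lam / 8)) ^ ((d : ℝ) / 2) *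
    (m * (4 / √lam) + √(m / δ))

lemma absCollision_le_gauss {N m : ℕ} (h0 : 0 < ε) (hN : (N : ℝ) * ε ^ (d - 1) = 1) (hm : m ≤ N)
    {lam μ δ : ℝ} (hlam : 0 < lam) (hμ : lam / 2 ≤ μ) (hδ : 0 < δ) {c : ℝ≥0∞}
    {g : Config d (m + 1) → ℝ≥0∞} (hg : ∀ z, g z ≤ c * gauss μ z) (z : Config d m) :
    absCollision d N ε m g z ≤ c * ENNReal.ofReal (collisionBound d m lam δ) * gauss (μ - δ) z := by
  set R : ℝ := (volume : Measure (Vel d)).toSphere.real univ *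
    (Real.pi / (lam / 8)) ^ ((d : ℝ) / 2) with hR
  have hR0 : 0 ≤ R := by positivity
  -- The scaling `N ε^(d-1) = 1` enters here; `m ≤ N` keeps the prefactor between 0 and 1.
  have hfac : ‖((N : ℝ) - m) * ε ^ (d - 1)‖ₑ ≤ 1 := by
    have hmN : (m : ℝ) ≤ N := by exact_mod_cast hm
    have hp : 0 < ε ^ (d - 1) := by positivity
    rw [Real.enorm_eq_ofReal_abs, abs_of_nonneg (mul_nonneg (by linarith) hp.le)]
    refine ENNReal.ofReal_le_one.2 ?_
    rw [← hN]
    gcongr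
    have : (0 : ℝ) ≤ m := m.cast_nonneg
    linarith
  have hterm : ∀ i, ∫⁻ p, ‖(inner ℝ (p.1 : Vel d) (p.2 - (z i).2) : ℝ)‖ₑ * g (adjoin ε z i p.1 p.2)
      ∂(collisionMeasure d) ≤ c * gauss μ z * ENNReal.ofReal (R * (4 / √lam + ‖(z i).2‖)) := by
    intro i
    rw [hR, ← lintegral_gauss _ (by positivity) hlam, ← lintegral_const_mul _ (by fun_prop)]
    refine lintegral_mono fun p => ?_
    have hω : ‖(p.1 : Vel d)‖ = 1 := by simp
    have h1 := norm_integrand_le hlam hμ hω p.2 (z i).2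
    calc ‖(inner ℝ (p.1 : Vel d) (p.2 - (z i).2) : ℝ)‖ₑ * g (adjoin ε z i p.1 p.2)
        ≤ ‖(inner ℝ (p.1 : Vel d) (p.2 - (z i).2) : ℝ)‖ₑ * (c * gauss μ (adjoin ε z i p.1 p.2)) := by
          gcongr; exact hg _
      _ = c * gauss μ z * ENNReal.ofReal (|inner ℝ (p.1 : Vel d) (p.2 - (z i).2)| *
            Real.exp (-(μ * (‖p.2‖ ^ 2 / 2)))) := by
          unfold gauss
          rw [kineticEnergy_adjoin, Real.enorm_eq_ofReal_abs, mul_add, neg_add, Real.exp_add,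
            ENNReal.ofReal_mul (Real.exp_pos _).le, ENNReal.ofReal_mul (abs_nonneg _)]
          ring
      _ ≤ _ := by gcongr
  have hsum : gauss μ z * ∑ i, ENNReal.ofReal (R * (4 / √lam + ‖(z i).2‖)) ≤
      ENNReal.ofReal (collisionBound d m lam δ) * gauss (μ - δ) z := by
    rw [← ENNReal.ofReal_sum_of_nonneg fun i _ => by positivity]
    unfold gauss
    have hcb : 0 ≤ collisionBound d m lam δ := by unfold collisionBound; positivity
    rw [← ENNReal.ofReal_mul (Real.exp_pos _).le, ← ENNReal.ofReal_mul hcb]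
    refine ENNReal.ofReal_le_ofReal ?_
    have e : Real.exp (-(μ * kineticEnergy z)) =
        Real.exp (-((μ - δ) * kineticEnergy z)) * Real.exp (-(δ * kineticEnergy z)) := by
      rw [← Real.exp_add]; ring_nf
    have hE : Real.exp (-(δ * kineticEnergy z)) ≤ 1 := Real.exp_le_one_iff.2 (by
      have := mul_nonneg hδ.le (kineticEnergy_nonneg z)
      linarith)
    have hV := sum_norm_mul_exp_le z hδ
    rw [← Finset.mul_sum, Finset.sum_add_distrib, Finset.sum_const, Finset.card_univ,
      Fintype.card_fin, nsmul_eq_mul, e]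
    have hA : (0 : ℝ) ≤ m * (4 / √lam) := by positivity
    calc Real.exp (-((μ - δ) * kineticEnergy z)) * Real.exp (-(δ * kineticEnergy z)) *
          (R * (m * (4 / √lam) + ∑ i, ‖(z i).2‖))
        = R * (m * (4 / √lam) * Real.exp (-(δ * kineticEnergy z)) +
            (∑ i, ‖(z i).2‖) * Real.exp (-(δ * kineticEnergy z))) *
            Real.exp (-((μ - δ) * kineticEnergy z)) := by ring
      _ ≤ R * (m * (4 / √lam) * 1 + √(m / δ)) * Real.exp (-((μ - δ) * kineticEnergy z)) := by
          gcongr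
      _ = _ := by rw [mul_one, collisionBound]
  calc absCollision d N ε m g z
      ≤ 1 * ∑ i, c * gauss μ z * ENNReal.ofReal (R * (4 / √lam + ‖(z i).2‖)) := by
        unfold absCollision
        gcongr with i
        exact hterm i
    _ = c * (gauss μ z * ∑ i, ENNReal.ofReal (R * (4 / √lam + ‖(z i).2‖))) := by
        rw [one_mul, ← Finset.mul_sum, mul_assoc]
    _ ≤ c * (ENNReal.ofReal (collisionBound d m lam δ) * gauss (μ - δ) z) := by gcongr
    _ = _ := by rw [mul_assoc]

/-- With `δ = lam/(bs)` the velocity term is `√(mbs/lam)`, and `ms ≤ k²` makes it linear in `k`.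
Linear growth is what `1/s!` can compensate. The factor 5 is 4 from the Gaussian term plus 1 from
this one. -/
lemma collisionBound_le {m k s : ℕ} {lam b : ℝ} (hlam : 0 < lam) (hb : 1 ≤ b) (hs : 1 ≤ s)
    (hmk : m ≤ k) (hsk : s ≤ k) :
    collisionBound d m lam (lam / (b * s)) ≤ k * (√b *
      (5 * ((volume : Measure (Vel d)).toSphere.real univ * (8 * Real.pi) ^ ((d : ℝ) / 2))) /
        lam ^ (((d : ℝ) + 1) / 2)) := by
  set σ := (volume : Measure (Vel d)).toSphere.real univ
  have hσ : 0 ≤ σ := measureReal_nonneg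
  have hsl : 0 < √lam := Real.sqrt_pos.2 hlam
  have hb1 : 1 ≤ √b := Real.one_le_sqrt.2 hb
  have hmk' : (m : ℝ) ≤ k := by exact_mod_cast hmk
  have hsk' : (s : ℝ) ≤ k := by exact_mod_cast hsk
  have hs0 : (0 : ℝ) < s := by exact_mod_cast hs
  have h1 : √(m / (lam / (b * s))) ≤ k * √b / √lam := by
    have : (m : ℝ) / (lam / (b * s)) ≤ (k * √b / √lam) ^ 2 := by
      rw [div_pow, mul_pow, Real.sq_sqrt (by linarith), Real.sq_sqrt hlam.le, div_div_eq_mul_div]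
      have : (m : ℝ) * s ≤ k * k := by gcongr
      refine div_le_div_of_nonneg_right ?_ hlam.le
      nlinarith
    exact (Real.sqrt_le_sqrt this).trans_eq (Real.sqrt_sq (by positivity))
  have h2 : (m : ℝ) * (4 / √lam) ≤ 4 * (k * √b / √lam) := by
    have : (m : ℝ) * 1 ≤ k * √b := by gcongr
    rw [mul_div_assoc', mul_div_assoc']
    gcongr ?_ / _
    linarith
  have h3 : (Real.pi / (lam / 8)) ^ ((d : ℝ) / 2) = (8 * Real.pi) ^ ((d : ℝ) / 2) / lam ^ ((d : ℝ) / 2) := by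
    rw [← Real.div_rpow (by positivity) hlam.le]
    congr 1
    field_simp
  have h4 : lam ^ (((d : ℝ) + 1) / 2) = lam ^ ((d : ℝ) / 2) * √lam := by
    rw [Real.sqrt_eq_rpow, ← Real.rpow_add hlam]; ring_nf
  unfold collisionBound
  rw [h3, h4]
  calc σ * ((8 * Real.pi) ^ ((d : ℝ) / 2) / lam ^ ((d : ℝ) / 2)) *
        (m * (4 / √lam) + √(m / (lam / (b * s))))
      ≤ σ * ((8 * Real.pi) ^ ((d : ℝ) / 2) / lam ^ ((d : ℝ) / 2)) *
        (4 * (k * √b / √lam) + k * √b / √lam) := by gcongr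
    _ = _ := by field_simp; ring

/-- The hypothesis `hμ` keeps the weight at or above `lam/2` throughout, so the same constant `L`
serves every collision. -/
lemma chain_le_gauss {N : ℕ} {lam δ : ℝ} (hδ : 0 < δ) {L : ℝ≥0∞} (s : ℕ)
    (hL : ∀ m < n + s, ∀ μ, lam / 2 ≤ μ → ∀ (c : ℝ≥0∞) (g : Config d (m + 1) → ℝ≥0∞),
      (∀ z, g z ≤ c * gauss μ z) → ∀ z, absCollision d N ε m g z ≤ c * L * gauss (μ - δ) z)
    {μ : ℝ} (hμ : lam / 2 ≤ μ - s * δ) {c : ℝ≥0∞} {g : Config d (n + s) → ℝ≥0∞}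
    (hg : ∀ z, g z ≤ c * gauss μ z) (θ : Fin (s + 1) → ℝ) (z : Config d n) :
    chain ε (absCollision d N ε) n s θ g z ≤ c * L ^ s * gauss (μ - s * δ) z := by
  induction s generalizing μ c with
  | zero => simpa [chain] using hg z
  | succ s ih =>
    simp only [chain]
    push_cast at hμ ⊢
    have hsδ : (0 : ℝ) ≤ s * δ := by positivity
    have h1 := hL (n + s) (by omega) μ (by nlinarith) c g hg
    have h2 := ih (fun m hm => hL m (by omega)) (μ := μ - δ) (c := c * L)
      (g := transport ε (θ (Fin.last s).castSucc - θ (Fin.last (s + 1)))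
        (absCollision d N ε (n + s) g)) (by linarith)
      (fun z => transport_le_gauss h1 _ z) (Fin.init θ)
    refine h2.trans_eq ?_
    rw [pow_succ', show μ - δ - s * δ = μ - (s + 1) * δ by ring, ← mul_assoc]

lemma enorm_transport_le {f : Config d n → ℝ} {g : Config d n → ℝ≥0∞} (h : ∀ z, ‖f z‖ₑ ≤ g z)
    (t : ℝ) (z : Config d n) : ‖transport ε t f z‖ₑ ≤ transport ε t g z := by
  unfold transport
  split_ifs with hz
  · exact h _
  · simp

lemma enorm_collision_le {N : ℕ} {f : Config d (n + 1) → ℝ} {g : Config d (n + 1) → ℝ≥0∞}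
    (h : ∀ z, ‖f z‖ₑ ≤ g z) (z : Config d n) :
    ‖collision d N ε n f z‖ₑ ≤ absCollision d N ε n g z := by
  unfold collision absCollision
  rw [enorm_mul]
  gcongr
  refine (enorm_sum_le _ _).trans (Finset.sum_le_sum fun i _ => ?_)
  refine (enorm_integral_le_lintegral_enorm _).trans (lintegral_mono fun p => ?_)
  rw [enorm_mul]
  gcongr
  exact h _

lemma enorm_chain_le {N : ℕ} (s : ℕ) {f : Config d (n + s) → ℝ} {g : Config d (n + s) → ℝ≥0∞}
    (h : ∀ z, ‖f z‖ₑ ≤ g z) (θ : Fin (s + 1) → ℝ) (z : Config d n) :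
    ‖chain ε (collision d N ε) n s θ f z‖ₑ ≤ chain ε (absCollision d N ε) n s θ g z := by
  induction s with
  | zero => exact h z
  | succ s ih =>
    simp only [chain]
    exact ih (fun z => enorm_transport_le (fun z => enorm_collision_le h z) _ z) _

lemma transport_zero {M : Type} [Zero M] (t : ℝ) :
    transport ε t (0 : Config d n → M) = 0 := by
  funext z
  unfold transport
  split_ifs <;> rfl

lemma absCollision_zero (N : ℕ) : absCollision d N ε n 0 = 0 := by
  funext z
  simp [absCollision]

lemma chain_zero {N : ℕ} (s : ℕ) (θ : Fin (s + 1) → ℝ) :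
    chain ε (absCollision d N ε) n s θ 0 = 0 := by
  induction s with
  | zero => rfl
  | succ s ih =>
    simp only [chain]
    rw [absCollision_zero, transport_zero, ih]

/-- The composition passes through `C_N`, whose factor `N - N` is zero. This removes the indices `m
> N`, for which the prefactor is not bounded by 1. -/
lemma chain_eq_zero {N : ℕ} (s : ℕ) (hn : n ≤ N) (hs : N < n + s) (θ : Fin (s + 1) → ℝ)
    (g : Config d (n + s) → ℝ≥0∞) : chain ε (absCollision d N ε) n s θ g = 0 := by
  induction s with
  | zero => omega
  | succ s ih =>
    simp only [chain]
    rcases Nat.lt_or_ge N (n + s) with h | h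
    · exact ih h _ _
    · have : absCollision d N ε (n + s) g = 0 := by
        funext z
        have hN : N = n + s := by omega
        subst hN
        simp [absCollision]
      rw [this, transport_zero, chain_zero]

end Bounds

/-! ### Volume of the time simplex. -/

section Simplex

lemma isClosed_simplexFibers (s : ℕ) (t : ℝ) :
    IsClosed {p : ℝ × (Fin s → ℝ) | (0 ≤ p.1 ∧ p.1 ≤ t) ∧ p.2 ∈ timeSimplex s p.1} := by
  have : {p : ℝ × (Fin s → ℝ) | (0 ≤ p.1 ∧ p.1 ≤ t) ∧ p.2 ∈ timeSimplex s p.1} =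
      {p | 0 ≤ p.1} ∩ {p | p.1 ≤ t} ∩ (⋂ (i) (j) (_ : i ≤ j), {p | p.2 j ≤ p.2 i}) ∩
        ⋂ k, {p | 0 ≤ p.2 k} ∩ {p | p.2 k ≤ p.1} := by
    ext p
    simp only [timeSimplex, Antitone, mem_ofPred_eq, mem_inter_iff, mem_iInter]
    tauto
  rw [this]
  refine (((isClosed_le continuous_const continuous_fst).inter
    (isClosed_le continuous_fst continuous_const)).inter ?_).inter ?_
  · exact isClosed_iInter fun i => isClosed_iInter fun j => isClosed_iInter fun _ =>
      isClosed_le (by fun_prop) (by fun_prop)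
  · exact isClosed_iInter fun k => (isClosed_le continuous_const (by fun_prop)).inter
      (isClosed_le (by fun_prop) continuous_fst)

/-- Once the largest time `x`, of index 0, is fixed, the others lie in the simplex of size `x`, and
`x^s/s!` is integrated over `[0, t]`. -/
lemma volume_timeSimplex_le (s : ℕ) {t : ℝ} (ht : 0 ≤ t) :
    volume (timeSimplex s t) ≤ ENNReal.ofReal (t ^ s / s.factorial) := by
  induction s generalizing t with
  | zero =>
    refine (measure_mono (subset_univ _)).trans ?_
    simp [volume_pi]
  | succ s ih =>
    have hmp := volume_preserving_piFinSuccAbove (fun _ : Fin (s + 1) => ℝ) 0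
    set T : Set (ℝ × (Fin s → ℝ)) :=
      {p | (0 ≤ p.1 ∧ p.1 ≤ t) ∧ p.2 ∈ timeSimplex s p.1} with hT
    have hTm : MeasurableSet T := (isClosed_simplexFibers s t).measurableSet
    have hsub : timeSimplex (s + 1) t ⊆
        MeasurableEquiv.piFinSuccAbove (fun _ : Fin (s + 1) => ℝ) 0 ⁻¹' T := by
      rintro τ ⟨hτ, hb⟩
      refine ⟨hb 0, fun i j hij => ?_, fun k => ⟨(hb _).1, ?_⟩⟩
      · exact hτ (Fin.succAbove_le_succAbove_iff.2 hij)
      · exact hτ (Fin.zero_le _)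
    refine (measure_mono hsub).trans ?_
    rw [hmp.measure_preimage hTm.nullMeasurableSet, Measure.volume_eq_prod, Measure.prod_apply hTm]
    have hle : ∀ x, volume (Prod.mk x ⁻¹' T) ≤
        (Icc 0 t).indicator (fun x => ENNReal.ofReal (x ^ s / s.factorial)) x := by
      intro x
      by_cases hx : x ∈ Icc 0 t
      · rw [indicator_of_mem hx]
        exact (measure_mono fun τ hτ => hτ.2).trans (ih hx.1)
      · rw [indicator_of_notMem hx, nonpos_iff_eq_zero]
        have : Prod.mk x ⁻¹' T = ∅ := by
          ext τ
          simp only [hT, mem_preimage, mem_empty_iff_false, iff_false]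
          exact fun h => hx h.1
        rw [this, measure_empty]
    refine (lintegral_mono hle).trans ?_
    rw [lintegral_indicator measurableSet_Icc, ← ofReal_integral_eq_lintegral_ofReal]
    · refine ENNReal.ofReal_le_ofReal (le_of_eq ?_)
      rw [integral_Icc_eq_integral_Ioc, ← intervalIntegral.integral_of_le ht,
        intervalIntegral.integral_div, integral_pow, Nat.factorial_succ]
      push_cast
      field_simp
      simp
    · exact (by fun_prop : Continuous fun x : ℝ => x ^ s / s.factorial).integrableOn_Icc
    · filter_upwards [ae_restrict_mem measurableSet_Icc] with x hx
      have := hx.1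
      positivity

end Simplex

/-! ### Assembling the estimates -/

section Main

variable {d n : ℕ} {ε : ℝ}

/-- A function of finite weighted norm agrees almost everywhere with a Borel function satisfying
the corresponding bound everywhere. -/
lemma MemWeighted.exists_measurable_bounded {lam : ℝ} {f : Config d n → ℝ}
    (hf : MemWeighted ε lam f) : ∃ f₀ : Config d n → ℝ, Measurable f₀ ∧
      f =ᵐ[domainMeasure d n ε] f₀ ∧ ∀ z, ‖f₀ z‖ₑ ≤ weightedNorm ε lam f * gauss lam z := by
  have hf1 := hf.1.stronglyMeasurable_mk.measurable
  set f₁ := hf.1.mk f with hf₁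
  have mgauss : Measurable (gauss lam : Config d n → ℝ≥0∞) := by
    unfold gauss kineticEnergy; fun_prop
  have hS : MeasurableSet {z | ‖f₁ z‖ₑ ≤ weightedNorm ε lam f * gauss lam z} :=
    measurableSet_le hf1.enorm (mgauss.const_mul _)
  -- Cutting off at the points where the bound fails changes the function only on a null set and
  -- makes the bound hold everywhere.
  refine ⟨indicator {z | ‖f₁ z‖ₑ ≤ weightedNorm ε lam f * gauss lam z} f₁, hf1.indicator hS, ?_, ?_⟩
  · filter_upwards [hf.1.ae_eq_mk, ae_le_eLpNormEssSup
      (f := fun z => f z * Real.exp (lam * kineticEnergy z)) (μ := domainMeasure d n ε)] with z h1 h2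
    rw [indicator_of_mem, h1]
    rw [← hf₁] at h1
    change ‖f₁ z‖ₑ ≤ _
    rw [← h1]
    unfold weightedNorm gauss
    rw [eLpNorm_exponent_top]
    calc ‖f z‖ₑ = ‖f z * Real.exp (lam * kineticEnergy z)‖ₑ *
          ENNReal.ofReal (Real.exp (-(lam * kineticEnergy z))) := by
          rw [← Real.enorm_of_nonneg (Real.exp_pos _).le, ← enorm_mul, mul_assoc, ← Real.exp_add]
          simp
      _ ≤ _ := by gcongr
  · intro z
    by_cases hz : z ∈ {z | ‖f₁ z‖ₑ ≤ weightedNorm ε lam f * gauss lam z}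
    · rw [indicator_of_mem hz]; exact hz
    · rw [indicator_of_notMem hz]; simp

lemma weightedNorm_le_of_enorm_le {lam : ℝ} {f : Config d n → ℝ} {c : ℝ≥0∞}
    (h : ∀ᵐ z ∂domainMeasure d n ε, ‖f z‖ₑ ≤ c * gauss lam z) : weightedNorm ε lam f ≤ c := by
  unfold weightedNorm
  rw [eLpNorm_exponent_top]
  refine eLpNormEssSup_le_of_ae_enorm_bound ?_
  filter_upwards [h] with z hz
  rw [enorm_mul, Real.enorm_of_nonneg (Real.exp_pos _).le]
  calc ‖f z‖ₑ * ENNReal.ofReal (Real.exp (lam * kineticEnergy z))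
      ≤ c * gauss lam z * ENNReal.ofReal (Real.exp (lam * kineticEnergy z)) := by gcongr
    _ = c := by
      unfold gauss
      rw [mul_assoc, ← ENNReal.ofReal_mul (Real.exp_pos _).le, ← Real.exp_add]
      simp

lemma collision_congr {N : ℕ} (f g : Config d (n + 1) → ℝ) (z : Config d n)
    (h : ∀ i, ∀ᵐ p ∂collisionMeasure d, inner ℝ (p.1 : Vel d) (p.2 - (z i).2) ≠ (0 : ℝ) →
      f (adjoin ε z i p.1 p.2) = g (adjoin ε z i p.1 p.2)) :
    collision d N ε n f z = collision d N ε n g z := by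
  unfold collision
  congr 1
  refine Finset.sum_congr rfl fun i _ => integral_congr_ae ?_
  filter_upwards [h i] with p hp
  by_cases h0 : inner ℝ (p.1 : Vel d) (p.2 - (z i).2) = (0 : ℝ)
  · rw [h0, zero_mul, zero_mul]
  · rw [hp h0]

lemma absCollision_congr {N : ℕ} (f g : Config d (n + 1) → ℝ≥0∞) (z : Config d n)
    (h : ∀ i, ∀ᵐ p ∂collisionMeasure d, inner ℝ (p.1 : Vel d) (p.2 - (z i).2) ≠ (0 : ℝ) →
      f (adjoin ε z i p.1 p.2) = g (adjoin ε z i p.1 p.2)) :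
    absCollision d N ε n f z = absCollision d N ε n g z := by
  unfold absCollision
  congr 1
  refine Finset.sum_congr rfl fun i _ => lintegral_congr_ae ?_
  filter_upwards [h i] with p hp
  by_cases h0 : inner ℝ (p.1 : Vel d) (p.2 - (z i).2) = (0 : ℝ)
  · rw [h0, enorm_zero, zero_mul, zero_mul]
  · rw [hp h0]

lemma Q_congr_ae (hd : 0 < d) (h0 : 0 < ε) (h1 : ε < 1 / 2) (N s : ℕ) (t : ℝ)
    {f g : Config d (n + s) → ℝ} (hfg : f =ᵐ[domainMeasure d (n + s) ε] g) :
    Q d N ε n s t f =ᵐ[domainMeasure d n ε] Q d N ε n s t g := by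
  have h := chain_congr_ae_ae (n := n) hd h0 h1 (collision d N ε)
    (fun _ => collision_congr) t s hfg
  filter_upwards [ae_restrict_of_ae h] with z hz
  exact integral_congr_ae (ae_restrict_of_ae hz)

lemma absQ_congr_ae (hd : 0 < d) (h0 : 0 < ε) (h1 : ε < 1 / 2) (N s : ℕ) (t : ℝ)
    {f g : Config d (n + s) → ℝ} (hfg : f =ᵐ[domainMeasure d (n + s) ε] g) :
    absQ d N ε n s t f =ᵐ[domainMeasure d n ε] absQ d N ε n s t g := by
  have h := chain_congr_ae_ae (n := n) hd h0 h1 (absCollision d N ε)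
    (fun _ => absCollision_congr) t s (f := fun w => ‖f w‖ₑ) (g := fun w => ‖g w‖ₑ)
    (hfg.fun_comp enorm)
  filter_upwards [ae_restrict_of_ae h] with z hz
  exact lintegral_congr_ae (ae_restrict_of_ae hz)

lemma enorm_Q_le_absQ (N s : ℕ) (t : ℝ) (f : Config d (n + s) → ℝ) (z : Config d n) :
    ‖Q d N ε n s t f z‖ₑ ≤ absQ d N ε n s t f z := by
  unfold Q absQ
  refine (enorm_integral_le_lintegral_enorm _).trans (lintegral_mono fun τ => ?_)
  exact enorm_chain_le s (fun z => enorm_transport_le (fun _ => le_rfl) _ z) _ z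

lemma measurable_Q (h0 : 0 < ε) (h1 : ε < 1 / 2) (N s : ℕ) (t : ℝ) {f : Config d (n + s) → ℝ}
    (hf : Measurable f) : Measurable (Q d N ε n s t f) := by
  have h := measurable_chain (n := n) h0 h1 (collision d N ε)
    (fun m X _ F hF => measurable_collision N hF) t s (X := Unit) (fun _ => f)
    (hf.comp measurable_snd) (fun _ => 0) measurable_const
  have h2 : Measurable fun p : Config d n × (Fin s → ℝ) => chain ε (collision d N ε) n s
      (Fin.cons t p.2) (transport ε ((Fin.cons t p.2 : Fin (s + 1) → ℝ) (Fin.last s)) f) p.1 := by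
    have h3 := h.comp (f := fun p : Config d n × (Fin s → ℝ) => (((), p.2), p.1)) (by fun_prop)
    simpa only [Function.comp_def, sub_zero] using h3
  exact (h2.stronglyMeasurable.integral_prod_right
    (f := fun (z : Config d n) (τ : Fin s → ℝ) => chain ε (collision d N ε) n s
      (Fin.cons t τ) (transport ε ((Fin.cons t τ : Fin (s + 1) → ℝ) (Fin.last s)) f) z)).measurable

/-- The constant of the continuity estimate. -/
def continuityConstant (d : ℕ) : ℝ :=
  Real.exp 1 * (5 * ((volume : Measure (Vel d)).toSphere.real univ *
    (8 * Real.pi) ^ ((d : ℝ) / 2)))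

lemma continuityConstant_pos (hd : 0 < d) : 0 < continuityConstant d := by
  have : Nonempty (Fin d) := ⟨⟨0, hd⟩⟩
  have h : 0 < (volume : Measure (Vel d)).toSphere.real univ := by
    rw [Measure.toSphere_real_apply_univ]
    have h1 : 0 < (volume : Measure (Vel d)).real (Metric.ball 0 1) :=
      ENNReal.toReal_pos (Metric.measure_ball_pos _ _ one_pos).ne' measure_ball_lt_top.ne
    have h2 : 0 < Module.finrank ℝ (Vel d) := by simpa using hd
    positivity
  unfold continuityConstant
  positivity

lemma absQ_le_gauss (h0 : 0 < ε) {N s : ℕ} (hN : (N : ℝ) * ε ^ (d - 1) = 1) (hs : 1 ≤ s)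
    (hn : n ≤ N) {t lam b : ℝ} (ht : 0 < t) (hlam : 0 < lam) (hb : 2 ≤ b)
    {f : Config d (n + s) → ℝ} {c : ℝ≥0∞} (hf : ∀ z, ‖f z‖ₑ ≤ c * gauss lam z) (z : Config d n) :
    absQ d N ε n s t f z ≤ ENNReal.ofReal (Real.exp n *
      (√b * continuityConstant d * t / lam ^ (((d : ℝ) + 1) / 2)) ^ s) * c *
        gauss (lam * (1 - 1 / b)) z := by
  -- If `n + s > N` the operator is zero; otherwise every index `m < n + s` is at most `N`, as the
  -- one-step bound requires.
  rcases Nat.lt_or_ge N (n + s) with hlt | hge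
  · have : absQ d N ε n s t f z = 0 := by
      unfold absQ
      simp only [chain_eq_zero s hn hlt, Pi.zero_apply, lintegral_zero]
    rw [this]
    exact zero_le
  set σ : ℝ := 5 * ((volume : Measure (Vel d)).toSphere.real univ *
    (8 * Real.pi) ^ ((d : ℝ) / 2)) with hσ
  set Λ : ℝ := lam ^ (((d : ℝ) + 1) / 2) with hΛ
  have hΛ0 : 0 < Λ := Real.rpow_pos_of_pos hlam _
  have hσ0 : 0 ≤ σ := by positivity
  obtain ⟨k, hk⟩ : ∃ k, k = n + s := ⟨_, rfl⟩
  set L : ℝ := k * (√b * σ / Λ) with hL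
  have hL0 : 0 ≤ L := by positivity
  have hs0 : (0 : ℝ) < s := by exact_mod_cast hs
  set δ : ℝ := lam / (b * s) with hδ
  have hδ0 : 0 < δ := by positivity
  have hsδ : (s : ℝ) * δ = lam / b := by rw [hδ]; field_simp
  have hμ : lam - s * δ = lam * (1 - 1 / b) := by rw [hsδ]; ring
  -- The assumption `b ≥ 2` is used here: the total loss `lam/b` is at most half of the weight.
  have hhalf : lam / 2 ≤ lam - s * δ := by
    have : lam / b ≤ lam / 2 := by gcongr
    rw [hsδ]; linarith
  have hstep : ∀ m < n + s, ∀ μ, lam / 2 ≤ μ → ∀ (c : ℝ≥0∞) (g : Config d (m + 1) → ℝ≥0∞),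
      (∀ z, g z ≤ c * gauss μ z) → ∀ z,
        absCollision d N ε m g z ≤ c * ENNReal.ofReal L * gauss (μ - δ) z := by
    intro m hm μ hμ c g hg z
    refine (absCollision_le_gauss h0 hN (by omega) hlam hμ hδ0 hg z).trans ?_
    gcongr
    exact collisionBound_le hlam (by linarith) hs (by omega) (by omega)
  have hchain : ∀ τ : Fin s → ℝ, chain ε (absCollision d N ε) n s (Fin.cons t τ)
      (transport ε ((Fin.cons t τ : Fin (s + 1) → ℝ) (Fin.last s)) (fun w => ‖f w‖ₑ)) z ≤
        c * ENNReal.ofReal L ^ s * gauss (lam * (1 - 1 / b)) z := by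
    intro τ
    rw [← hμ]
    exact chain_le_gauss hδ0 s hstep hhalf (transport_le_gauss hf _) _ z
  -- With `k = n + s`, `k^s/s! ≤ e^k = e^n · e^s`; the factor `e^s` goes into the `s`-th power and
  -- explains `exp 1` in the constant.
  have hfinal : L ^ s * (t ^ s / s.factorial) ≤
      Real.exp n * (√b * continuityConstant d * t / Λ) ^ s := by
    have h1 : (k : ℝ) ^ s / s.factorial ≤ Real.exp k :=
      Real.pow_div_factorial_le_exp k k.cast_nonneg s
    have h2 : Real.exp k = Real.exp n * Real.exp 1 ^ s := by
      rw [← Real.exp_nat_mul, ← Real.exp_add, hk]; push_cast; ring_nf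
    calc L ^ s * (t ^ s / s.factorial) =
        ((k : ℝ) ^ s / s.factorial) * (√b * σ * t / Λ) ^ s := by
          rw [hL, mul_pow, div_pow, div_pow, mul_pow (√b * σ) t]; ring
      _ ≤ Real.exp k * (√b * σ * t / Λ) ^ s := by gcongr
      _ = _ := by
          rw [h2, mul_assoc, ← mul_pow]
          unfold continuityConstant
          rw [← hσ]
          ring
  calc absQ d N ε n s t f z
      ≤ ∫⁻ _ in timeSimplex s t, c * ENNReal.ofReal L ^ s * gauss (lam * (1 - 1 / b)) z :=
        lintegral_mono fun τ => hchain τ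
    _ = c * ENNReal.ofReal L ^ s * gauss (lam * (1 - 1 / b)) z * volume (timeSimplex s t) := by
        rw [lintegral_const, Measure.restrict_apply_univ]
    _ ≤ c * ENNReal.ofReal L ^ s * gauss (lam * (1 - 1 / b)) z *
          ENNReal.ofReal (t ^ s / s.factorial) := by
        gcongr; exact volume_timeSimplex_le s ht.le
    _ = ENNReal.ofReal (L ^ s * (t ^ s / s.factorial)) * c * gauss (lam * (1 - 1 / b)) z := by
        rw [ENNReal.ofReal_mul (p := L ^ s) (by positivity), ENNReal.ofReal_pow hL0]; ring
    _ ≤ _ := by gcongr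

end Main

end

end HardSphere

theorem mainTheorem4 (d : ℕ) (hd : 2 ≤ d) :
    ∃ C : ℝ, 0 < C ∧
      ∀ (N : ℕ) (ε : ℝ), 0 < ε → ε < 1 / 2 → (N : ℝ) * ε ^ (d - 1) = 1 →
      ∀ n s : ℕ, 1 ≤ n → 1 ≤ s → n ≤ N →
      ∀ t lam : ℝ, 0 < t → 0 < lam →
      ∀ f : HardSphere.Config d (n + s) → ℝ, HardSphere.MemWeighted ε lam f →
        -- the integral defining `Q_{n,n+s}(t) f` converges absolutely almost everywhere
        (∀ᵐ z ∂(HardSphere.domainMeasure d n ε), HardSphere.absQ d N ε n s t f z < ∞) ∧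
        -- it depends only on the almost everywhere class of `f`
        (∀ g : HardSphere.Config d (n + s) → ℝ,
          g =ᵐ[HardSphere.domainMeasure d (n + s) ε] f →
          HardSphere.Q d N ε n s t g =ᵐ[HardSphere.domainMeasure d n ε]
            HardSphere.Q d N ε n s t f) ∧
        -- the continuity estimate
        ∀ b : ℝ, 2 ≤ b →
          HardSphere.MemWeighted ε (lam * (1 - 1 / b)) (HardSphere.Q d N ε n s t f) ∧
          HardSphere.weightedNorm ε (lam * (1 - 1 / b)) (HardSphere.Q d N ε n s t f) ≤
            ENNReal.ofReal
              (Real.exp n * (Real.sqrt b * C * t / lam ^ (((d : ℝ) + 1) / 2)) ^ s) *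
            HardSphere.weightedNorm ε lam f := by
  have hd0 : 0 < d := by omega
  refine ⟨HardSphere.continuityConstant d, HardSphere.continuityConstant_pos hd0, ?_⟩
  intro N ε h0 h1 hN n s _ hs hn t lam ht hlam f hf
  obtain ⟨f₀, hf₀m, hff₀, hf₀⟩ := hf.exists_measurable_bounded
  have hQ := HardSphere.Q_congr_ae (n := n) hd0 h0 h1 N s t hff₀
  have hbound := fun (b : ℝ) (hb : 2 ≤ b) =>
    HardSphere.absQ_le_gauss (n := n) h0 hN hs hn ht hlam hb hf₀
  refine ⟨?_, fun g hg => HardSphere.Q_congr_ae hd0 h0 h1 N s t hg, fun b hb => ?_⟩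
  · filter_upwards [HardSphere.absQ_congr_ae (n := n) hd0 h0 h1 N s t hff₀] with z hz
    rw [hz]
    -- Any admissible `b` proves finiteness; the smallest one is taken.
    refine (hbound 2 le_rfl z).trans_lt ?_
    exact ENNReal.mul_lt_top (ENNReal.mul_lt_top ENNReal.ofReal_lt_top hf.2) ENNReal.ofReal_lt_top
  · have hle : HardSphere.weightedNorm ε (lam * (1 - 1 / b)) (HardSphere.Q d N ε n s t f) ≤
        ENNReal.ofReal (Real.exp n * (Real.sqrt b * HardSphere.continuityConstant d * t /
          lam ^ (((d : ℝ) + 1) / 2)) ^ s) * HardSphere.weightedNorm ε lam f := by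
      refine HardSphere.weightedNorm_le_of_enorm_le ?_
      filter_upwards [hQ] with z hz
      rw [hz]
      exact (HardSphere.enorm_Q_le_absQ N s t f₀ z).trans (hbound b hb z)
    refine ⟨⟨⟨_, (HardSphere.measurable_Q h0 h1 N s t hf₀m).stronglyMeasurable, hQ⟩, ?_⟩, hle⟩
    exact hle.trans_lt (ENNReal.mul_lt_top ENNReal.ofReal_lt_top hf.2)
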